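/- **Theorem 1.** Consider $n\ge 1$ agents and $m\ge 0$ indivisible chores with additive costs, where agent $i$ has cost $c_{ij}$ for chore $j$, and suppose the instance is bivalued: there are real numbers $a,b>0$ with $c_{ij}\in\{a,b\}$ for all $i,j$. Write $c_i(S)=\sum_{j\in S}c_{ij}$. Then there is an allocation (a partition of the chores into bundles $\mathbf x_1,\dots,\mathbf x_n$, possibly empty) that is * EF1 (envy-free up to one chore): for all agents $i,h$, either $\mathbf x_i=\emptyset$ or there is $j\in \mathbf x_i$ with $c_i(\mathbf x_i\setminus\{j\})\le c_i(\mathbf x_h)$; and * fPO (fractionally Pareto-optimal): there is no $y\in[0,1]^{n\times m}$ with $\sum_i y_{ij}=1$ for every chore $j$ such that $\sum_j c_{ij}y_{ij}\le c_i(\mathbf x_i)$ for all agents $i$, with strict inequality for at least one agent. Moreover, there are prices $p_j>0$ such that $(\mathbf x,p)$ is on minimum bang-per-buck, i.e. $c_{ij}/p_j=\min_{j'}c_{ij'}/p_{j'}$ whenever $j\in\mathbf x_i$, and price-EF1, i.e. for all agents $i,h$, either $\mathbf x_i=\emptyset$ or there is $j\in\mathbf x_i$ with $\sum_{l\in \mathbf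 x_i\setminus\{j\}}p_l\le\sum_{l\in\mathbf x_h}p_l$. Such an allocation can be computed in strongly polynomial time: there is a single random access machine program (unit-cost arithmetic $+,-,\times,\div$ and comparisons on real numbers; addition, truncated subtraction, comparison and addressing on natural-number indices) that, given $n$, $m$ and the costs $c_{ij}$ of any such instance, outputs such an allocation after a number of steps that is polynomial in $n$ and $m$; and if all $c_{ij}$ are rational, then every number computed on the way is a rational number whose bit length is polynomial in the encoding length of the instance. -/

import Mathlib

/-! ## Indivisible chores: allocations, fairness, efficiency, prices

An instance with `n` agents and `m` chores is a cost matrix `c : Fin n → Fin m → ℝ`; the additive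
cost of a bundle `S` to agent `i` is `∑ j ∈ S, c i j`. -/

/-- A family of bundles is an allocation if it partitions the chores: every chore lies in exactly
one bundle (bundles may be empty). -/
def IsAllocation {n m : ℕ} (x : Fin n → Finset (Fin m)) : Prop :=
  ∀ j, ∃! i, j ∈ x i

/-- Envy-freeness up to one chore. An agent without chores envies nobody. -/
def EF1 {n m : ℕ} (c : Fin n → Fin m → ℝ) (x : Fin n → Finset (Fin m)) : Prop :=
  ∀ i h, x i = ∅ ∨ ∃ j ∈ x i, ∑ l ∈ (x i).erase j, c i l ≤ ∑ l ∈ x h, c i l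

/-- A fractional allocation: `y i j` is the fraction of chore `j` given to agent `i`. -/
def IsFracAllocation {n m : ℕ} (y : Fin n → Fin m → ℝ) : Prop :=
  (∀ i j, 0 ≤ y i j ∧ y i j ≤ 1) ∧ ∀ j, ∑ i, y i j = 1

/-- Fractional Pareto-optimality: no fractional allocation costs every agent at most as much as
the bundle she has, and some agent strictly less. -/
def FPO {n m : ℕ} (c : Fin n → Fin m → ℝ) (x : Fin n → Finset (Fin m)) : Prop :=
  ¬ ∃ y : Fin n → Fin m → ℝ, IsFracAllocation y ∧
    (∀ i, ∑ j, c i j * y i j ≤ ∑ j ∈ x i, c i j) ∧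
    ∃ h, ∑ j, c h j * y h j < ∑ j ∈ x h, c h j

/-- The set of chores with minimum bang-per-buck ratio `c i j / p j` for agent `i`. -/
def mBB {n m : ℕ} (c : Fin n → Fin m → ℝ) (p : Fin m → ℝ) (i : Fin n) : Set (Fin m) :=
  {j | ∀ j', c i j / p j ≤ c i j' / p j'}

/-- Agents only receive chores of minimum bang-per-buck. -/
def OnMBB {n m : ℕ} (c : Fin n → Fin m → ℝ) (x : Fin n → Finset (Fin m)) (p : Fin m → ℝ) : Prop :=
  ∀ i, ∀ j ∈ x i, j ∈ mBB c p i

/-- Price envy-freeness up to one chore. -/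
def PEF1 {n m : ℕ} (x : Fin n → Finset (Fin m)) (p : Fin m → ℝ) : Prop :=
  ∀ i h, x i = ∅ ∨ ∃ j ∈ x i, ∑ l ∈ (x i).erase j, p l ≤ ∑ l ∈ x h, p l

/-! ## A random access machine with exact arithmetic

The machine has two kinds of memory, both random access and organized in two-dimensional arrays
`A[i, j]` (array name, row and column are natural numbers, a program names its arrays by
constants): index cells hold natural numbers, which can be compared, added and subtracted (cut off
at `0`) and used as addresses; number cells hold real numbers, which can be compared, added,
subtracted, multiplied and divided. Nothing turns the contents of a number cell into an index except
the outcome of a comparison. Programs are structured (sequence, branch, loop) and finite, and one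
program serves all input sizes. All elementary operations have unit cost. As index arithmetic has no
multiplication, the indices occurring in the first `t` steps have `O(t)` more bits than the initial
ones. -/

/-- Memory contents. A cell `A[i, j]` is addressed by the triple `(A, i, j)`. -/
structure State where
  idx : ℕ × ℕ × ℕ → ℕ
  num : ℕ × ℕ × ℕ → ℝ

/-- Index expressions. -/
inductive IExpr where
  | const (k : ℕ)
  | read (A : ℕ) (i j : IExpr)
  | add (e f : IExpr)
  | sub (e f : IExpr)

/-- Value of an index expression. -/
def IExpr.eval (s : State) : IExpr → ℕ
  | .const k => k
  | .read A i j => s.idx (A, i.eval s, j.eval s)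
  | .add e f => e.eval s + f.eval s
  | .sub e f => e.eval s - f.eval s

/-- Cost of an index expression: one step for every node. -/
def IExpr.cost : IExpr → ℕ
  | .const _ => 1
  | .read _ i j => 1 + i.cost + j.cost
  | .add e f => 1 + e.cost + f.cost
  | .sub e f => 1 + e.cost + f.cost

/-- A cell `A[row, col]` whose row and column are computed by index expressions. -/
structure Cell where
  A : ℕ
  row : IExpr
  col : IExpr

/-- The address of a cell. -/
def Cell.addr (s : State) (r : Cell) : ℕ × ℕ × ℕ := (r.A, r.row.eval s, r.col.eval s)

/-- Cost of addressing a cell. -/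
def Cell.cost (r : Cell) : ℕ := 1 + r.row.cost + r.col.cost

/-- A single arithmetic operation on number cells, or an integer constant, or a copy. -/
inductive NumOp where
  | const (z : ℤ)
  | copy (u : Cell)
  | add (u v : Cell)
  | sub (u v : Cell)
  | mul (u v : Cell)
  | div (u v : Cell)

/-- `op.Result s y`: in state `s` the operation is defined and has the result `y`.
Division by zero has no result. -/
def NumOp.Result (s : State) (y : ℝ) : NumOp → Prop
  | .const z => y = z
  | .copy u => y = s.num (u.addr s)
  | .add u v => y = s.num (u.addr s) + s.num (v.addr s)
  | .sub u v => y = s.num (u.addr s) - s.num (v.addr s)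
  | .mul u v => y = s.num (u.addr s) * s.num (v.addr s)
  | .div u v => s.num (v.addr s) ≠ 0 ∧ y = s.num (u.addr s) / s.num (v.addr s)

/-- Cost of an arithmetic operation, addressing included. -/
def NumOp.cost : NumOp → ℕ
  | .const _ => 1
  | .copy u => 1 + u.cost
  | .add u v => 1 + u.cost + v.cost
  | .sub u v => 1 + u.cost + v.cost
  | .mul u v => 1 + u.cost + v.cost
  | .div u v => 1 + u.cost + v.cost

/-- Tests: comparisons of indices and of numbers, and their Boolean combinations. -/
inductive Test where
  | leIdx (e f : IExpr)
  | leNum (u v : Cell)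
  | neg (b : Test)
  | conj (b d : Test)

/-- Truth of a test. -/
def Test.Holds (s : State) : Test → Prop
  | .leIdx e f => e.eval s ≤ f.eval s
  | .leNum u v => s.num (u.addr s) ≤ s.num (v.addr s)
  | .neg b => ¬ b.Holds s
  | .conj b d => b.Holds s ∧ d.Holds s

/-- Cost of a test. -/
def Test.cost : Test → ℕ
  | .leIdx e f => 1 + e.cost + f.cost
  | .leNum u v => 1 + u.cost + v.cost
  | .neg b => 1 + b.cost
  | .conj b d => 1 + b.cost + d.cost

/-- Programs. -/
inductive Prog where
  | setIdx (r : Cell) (e : IExpr)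
  | setNum (r : Cell) (op : NumOp)
  | seq (P Q : Prog)
  | branch (b : Test) (P Q : Prog)
  | loop (b : Test) (P : Prog)

/-- `Exec P s t L s'`: started in state `s`, the program `P` halts in state `s'` after exactly `t`
steps, and `L` lists the results of all arithmetic operations on numbers that it performs. -/
inductive Exec : Prog → State → ℕ → List ℝ → State → Prop where
  | setIdx (r : Cell) (e : IExpr) (s : State) :
      Exec (.setIdx r e) s (r.cost + e.cost) []
        { s with idx := Function.update s.idx (r.addr s) (e.eval s) }
  | setNum (r : Cell) (op : NumOp) (s : State) (y : ℝ) (hy : op.Result s y) :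
      Exec (.setNum r op) s (r.cost + op.cost) [y]
        { s with num := Function.update s.num (r.addr s) y }
  | seq {P Q : Prog} {s s₁ s₂ : State} {t₁ t₂ : ℕ} {L₁ L₂ : List ℝ}
      (h₁ : Exec P s t₁ L₁ s₁) (h₂ : Exec Q s₁ t₂ L₂ s₂) :
      Exec (.seq P Q) s (t₁ + t₂) (L₁ ++ L₂) s₂
  | branchTrue {b : Test} {P Q : Prog} {s s₁ : State} {t : ℕ} {L : List ℝ}
      (hb : b.Holds s) (h : Exec P s t L s₁) : Exec (.branch b P Q) s (b.cost + t) L s₁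
  | branchFalse {b : Test} {P Q : Prog} {s s₁ : State} {t : ℕ} {L : List ℝ}
      (hb : ¬ b.Holds s) (h : Exec Q s t L s₁) : Exec (.branch b P Q) s (b.cost + t) L s₁
  | loopTrue {b : Test} {P : Prog} {s s₁ s₂ : State} {t₁ t₂ : ℕ} {L₁ L₂ : List ℝ}
      (hb : b.Holds s) (h₁ : Exec P s t₁ L₁ s₁) (h₂ : Exec (.loop b P) s₁ t₂ L₂ s₂) :
      Exec (.loop b P) s (b.cost + t₁ + t₂) (L₁ ++ L₂) s₂
  | loopFalse {b : Test} {P : Prog} {s : State} (hb : ¬ b.Holds s) :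
      Exec (.loop b P) s b.cost [] s

/-- The initial memory for an instance: the index cells `0[0, 0]` and `0[0, 1]` hold `n` and `m`,
the number cell `0[i, j]` holds `c i j`, and all other cells hold `0`. -/
noncomputable def inputState {n m : ℕ} (c : Fin n → Fin m → ℝ) : State where
  idx z := if z = (0, 0, 0) then n else if z = (0, 0, 1) then m else 0
  num z := if h : z.1 = 0 ∧ z.2.1 < n ∧ z.2.2 < m then c ⟨z.2.1, h.2.1⟩ ⟨z.2.2, h.2.2⟩ else 0

/-- The family of bundles read off the final memory: the index cell `1[0, j]` holds the agent who
receives chore `j`. -/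
def outputBundles (n m : ℕ) (s : State) : Fin n → Finset (Fin m) :=
  fun i => Finset.univ.filter fun j => s.idx (1, 0, (j : ℕ)) = i

/-- Number of bits of a rational number: numerator, denominator and sign. -/
def ratBits (q : ℚ) : ℕ := q.num.natAbs.size + q.den.size + 1

/-- Encoding length of a rational instance. -/
def instBits {n m : ℕ} (q : Fin n → Fin m → ℚ) : ℕ := n + m + ∑ i, ∑ j, ratBits (q i j)

/-! Let `lo ≤ hi` be the least and the greatest cost. A chore that is easy for somebody, that is, as
cheap for her as any other, is first given to such an agent at the price `lo`, while hard chores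
have the price `hi`. To balance an allocation is to remove price-envy up to one chore by passing
chores along chains of agents who may own them. Every such step moves a chore to a lower slot in
the order of the loads, and so decreases an integer potential that is polynomial in `n` and `m`.

Once the easy chores are balanced, the agents with at least `τ` of them, together with all agents
whom they can reach along such chains, have at least `τ - 1` each, and nobody else finds a chore of
theirs easy. So the prices of their chores can be raised to `hi` without leaving minimum
bang-per-buck, and the chores of price `hi` can be balanced in turn. As `τ` is lowered step by step,
owners of chores of price `hi` never envy anybody up to one chore. Hence envy requires somebody with
fewer than `τ - 2` easy chores, and it dies out when `τ` is small. The first stage without envy is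
price-EF1, which on minimum bang-per-buck implies EF1, and positive prices certify fPO.

Prices and loads are the only numbers computed on the way. Each of them is a combination of `lo` and
`hi` with integer coefficients of absolute value at most `m + 1`, which bounds the bit lengths. -/

namespace BivaluedChores

section Prices

variable {n m : ℕ} {c : Fin n → Fin m → ℝ} {p : Fin m → ℝ}

/-- The family of bundles in which every chore `j` goes to `o j`. The algorithm only handles
allocations in this form. -/
def bundles (o : Fin m → Fin n) (i : Fin n) : Finset (Fin m) :=
  Finset.univ.filter fun j => o j = i

@[simp]
theorem mem_bundles {o : Fin m → Fin n} {i : Fin n} {j : Fin m} : j ∈ bundles o i ↔ o j = i := by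
  simp [bundles]

theorem isAllocation_bundles (o : Fin m → Fin n) : IsAllocation (bundles o) := fun j =>
  ⟨o j, mem_bundles.2 rfl, fun _ hi => (mem_bundles.1 hi).symm⟩

theorem exists_ratio_of_onMBB {x : Fin n → Finset (Fin m)} (hc : ∀ i j, 0 < c i j)
    (hp : ∀ j, 0 < p j) (h : OnMBB c x p) (i : Fin n) :
    ∃ r : ℝ, 0 < r ∧ (∀ l, r * p l ≤ c i l) ∧ ∀ l ∈ x i, c i l = r * p l := by
  rcases isEmpty_or_nonempty (Fin m) with he | hne
  · exact ⟨1, one_pos, fun l => he.elim l, fun l => he.elim l⟩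
  · obtain ⟨j, hj⟩ := Finite.exists_min fun j => c i j / p j
    refine ⟨c i j / p j, div_pos (hc i j) (hp j), fun l => ?_, fun l hl => ?_⟩
    · exact (le_div_iff₀ (hp l)).1 (hj l)
    · exact (div_eq_iff (hp l).ne').1 (le_antisymm (h i l hl j) (hj l))

theorem ef1_of_onMBB {x : Fin n → Finset (Fin m)} (hc : ∀ i j, 0 < c i j) (hp : ∀ j, 0 < p j)
    (h : OnMBB c x p) (hx : PEF1 x p) : EF1 c x := by
  intro i k
  obtain ⟨r, hr, hle, heq⟩ := exists_ratio_of_onMBB hc hp h i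
  refine (hx i k).imp_right ?_
  rintro ⟨j, hj, hjk⟩
  refine ⟨j, hj, ?_⟩
  calc ∑ l ∈ (x i).erase j, c i l = r * ∑ l ∈ (x i).erase j, p l := by
        rw [Finset.mul_sum]
        exact Finset.sum_congr rfl fun l hl => heq l (Finset.mem_of_mem_erase hl)
    _ ≤ r * ∑ l ∈ x k, p l := by gcongr
    _ ≤ ∑ l ∈ x k, c i l := by
        rw [Finset.mul_sum]
        exact Finset.sum_le_sum fun l _ => hle l

theorem exists_ratio_sum_of_onMBB {x : Fin n → Finset (Fin m)} (hc : ∀ i j, 0 < c i j)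
    (hp : ∀ j, 0 < p j) (h : OnMBB c x p) (i : Fin n) :
    ∃ r : ℝ, 0 < r ∧ ∑ j ∈ x i, c i j = r * ∑ j ∈ x i, p j ∧
      ∀ w : Fin m → ℝ, (∀ j, 0 ≤ w j) → r * ∑ j, p j * w j ≤ ∑ j, c i j * w j := by
  obtain ⟨r, hr, hle, heq⟩ := exists_ratio_of_onMBB hc hp h i
  refine ⟨r, hr, ?_, fun w hw => ?_⟩
  · rw [Finset.mul_sum]
    exact Finset.sum_congr rfl heq
  · rw [Finset.mul_sum]
    refine Finset.sum_le_sum fun j _ => ?_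
    rw [← mul_assoc]
    exact mul_le_mul_of_nonneg_right (hle j) (hw j)

theorem sum_price_eq_of_isFracAllocation {y : Fin n → Fin m → ℝ} (hy : IsFracAllocation y)
    (o : Fin m → Fin n) : ∑ i, ∑ j, p j * y i j = ∑ i, ∑ j ∈ bundles o i, p j := by
  rw [Finset.sum_comm]
  simp only [← Finset.mul_sum, hy.2, mul_one, bundles, Finset.sum_fiberwise]

theorem fpo_of_onMBB {o : Fin m → Fin n} (hc : ∀ i j, 0 < c i j) (hp : ∀ j, 0 < p j)
    (h : OnMBB c (bundles o) p) : FPO c (bundles o) := by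
  rintro ⟨y, hy, hle, k, hk⟩
  refine (sum_price_eq_of_isFracAllocation (p := p) hy o).not_lt
    (Finset.sum_lt_sum (fun i _ => ?_) ⟨k, Finset.mem_univ _, ?_⟩)
  · obtain ⟨r, hr, heq, hge⟩ := exists_ratio_sum_of_onMBB hc hp h i
    exact le_of_mul_le_mul_left ((hge _ fun j => (hy.1 i j).1).trans ((hle i).trans_eq heq)) hr
  · obtain ⟨r, hr, heq, hge⟩ := exists_ratio_sum_of_onMBB hc hp h k
    exact lt_of_mul_lt_mul_left ((hge _ fun j => (hy.1 k j).1).trans_lt (hk.trans_eq heq)) hr.le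

end Prices

section Counts

variable {n m : ℕ}

open Classical in
/-- The number of chores from `S` that `i` owns. -/
noncomputable def count (o : Fin m → Fin n) (S : Set (Fin m)) (i : Fin n) : ℕ :=
  ((bundles o i).filter (· ∈ S)).card

variable {o o' : Fin m → Fin n} {S S' : Set (Fin m)} {i : Fin n}

theorem count_pos : 0 < count o S i ↔ ∃ j ∈ S, o j = i := by
  classical
  simp only [count, Finset.card_pos, Finset.Nonempty, Finset.mem_filter, mem_bundles]
  exact exists_congr fun j => and_comm

theorem count_eq_zero : count o S i = 0 ↔ ∀ j ∈ S, o j ≠ i := by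
  simpa only [not_lt, Nat.le_zero, not_exists, not_and] using count_pos.not

theorem count_congr (h : ∀ j, o j = i ∧ j ∈ S ↔ o' j = i ∧ j ∈ S') :
    count o S i = count o' S' i := by
  classical
  simp only [count, bundles, Finset.filter_filter, h]

theorem count_le (o : Fin m → Fin n) (S : Set (Fin m)) (i : Fin n) : count o S i ≤ m := by
  classical
  exact (Finset.card_le_univ _).trans (by simp)

open Classical in
theorem sum_count (o : Fin m → Fin n) (S : Set (Fin m)) (R : Set (Fin n)) :
    ∑ f with f ∈ R, count o S f = (Finset.univ.filter fun j => j ∈ S ∧ o j ∈ R).card := by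
  rw [Finset.card_eq_sum_card_fiberwise (f := o) (t := Finset.univ.filter (· ∈ R))
    fun j hj => by simpa using (Finset.mem_filter.1 hj).2.2]
  refine Finset.sum_congr rfl fun f hf => congrArg Finset.card ?_
  ext j
  have hfR : f ∈ R := (Finset.mem_filter.1 hf).2
  simp only [bundles, Finset.mem_filter, Finset.mem_univ, true_and]
  constructor
  · rintro ⟨rfl, hj⟩
    exact ⟨⟨hj, hfR⟩, rfl⟩
  · rintro ⟨⟨hj, -⟩, hjf⟩
    exact ⟨hjf, hj⟩

theorem not_count_lt_of_forall_le {R : Set (Fin n)}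
    (hsub : ∀ j ∈ S, o j ∈ R → j ∈ S' ∧ o' j ∈ R)
    (hle : ∀ f ∈ R, count o' S' f ≤ count o S f) (hi : i ∈ R) :
    ¬ count o' S' i < count o S i := by
  classical
  intro hlt
  have hsum : ∑ f with f ∈ R, count o' S' f < ∑ f with f ∈ R, count o S f :=
    Finset.sum_lt_sum (fun f hf => hle f (Finset.mem_filter.1 hf).2)
      ⟨i, Finset.mem_filter.2 ⟨Finset.mem_univ i, hi⟩, hlt⟩
  rw [sum_count, sum_count] at hsum
  refine hsum.not_ge (Finset.card_le_card fun j hj => ?_)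
  simp only [Finset.mem_filter, Finset.mem_univ, true_and] at hj ⊢
  exact hsub j hj.1 hj.2

end Counts

/-- Two prices for the chores: `hi` on the set `high` and `lo` elsewhere. Only chores of high price
change hands, and agent `e` may receive such a chore `j` if `accepts e j`. -/
structure Pricing (n m : ℕ) where
  high : Set (Fin m)
  accepts : Fin n → Fin m → Prop
  lo : ℝ
  hi : ℝ

namespace Pricing

variable {n m : ℕ} (κ : Pricing n m) (o : Fin m → Fin n)

open Classical in
/-- The price of a chore. -/
noncomputable def price (j : Fin m) : ℝ := if j ∈ κ.high then κ.hi else κ.lo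

/-- The total price of the chores of an agent. -/
noncomputable def load (i : Fin n) : ℝ := ∑ j ∈ bundles o i, κ.price j

/-- The highest price of a chore of `i`. It is `lo` if `i` owns nothing, which is harmless because
then her load is `0`. -/
noncomputable def top (i : Fin n) : ℝ := if 0 < count o κ.high i then κ.hi else κ.lo

/-- Agent `i` can hand one of her chores to agent `e`. -/
def Link (i e : Fin n) : Prop := ∃ j ∈ κ.high, o j = i ∧ κ.accepts e j

/-- Agent `e` can be reached from `i` along links. -/
def Reach : Fin n → Fin n → Prop := Relation.ReflTransGen (κ.Link o)

/-- No agent price-envies, up to one chore, an agent whom she can reach. -/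
def Balanced : Prop := ∀ i e, κ.Reach o i e → κ.load o i ≤ κ.load o e + κ.top o i

variable {κ o} {i e : Fin n} {j : Fin m}

theorem price_of_mem (h : j ∈ κ.high) : κ.price j = κ.hi := if_pos h

theorem price_of_notMem (h : j ∉ κ.high) : κ.price j = κ.lo := if_neg h

theorem top_of_pos (h : 0 < count o κ.high i) : κ.top o i = κ.hi := if_pos h

theorem top_of_not_pos (h : ¬ 0 < count o κ.high i) : κ.top o i = κ.lo := if_neg h

theorem load_eq (κ : Pricing n m) (o : Fin m → Fin n) (i : Fin n) :
    κ.load o i = κ.hi * count o κ.high i + κ.lo * count o κ.highᶜ i := by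
  classical
  rw [load, ← Finset.sum_filter_add_sum_filter_not _ (· ∈ κ.high),
    Finset.sum_congr rfl fun j hj => price_of_mem (Finset.mem_filter.1 hj).2,
    Finset.sum_congr rfl fun j hj => price_of_notMem (Finset.mem_filter.1 hj).2]
  simp only [Finset.sum_const, nsmul_eq_mul, mul_comm, count, Set.mem_compl_iff]

theorem load_nonneg (hlo : 0 ≤ κ.lo) (hhi : 0 ≤ κ.hi) : 0 ≤ κ.load o i := by
  rw [load_eq]
  positivity

theorem exists_price_eq_top (h : (bundles o i).Nonempty) :
    ∃ j ∈ bundles o i, κ.price j = κ.top o i := by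
  by_cases hi : 0 < count o κ.high i
  · obtain ⟨j, hj, hji⟩ := count_pos.1 hi
    exact ⟨j, mem_bundles.2 hji, (price_of_mem hj).trans (top_of_pos hi).symm⟩
  · obtain ⟨j, hj⟩ := h
    refine ⟨j, hj, (price_of_notMem fun hjH => hi ?_).trans (top_of_not_pos hi).symm⟩
    exact count_pos.2 ⟨j, hjH, mem_bundles.1 hj⟩

theorem pef1_of_forall_load_le (h : ∀ i e, κ.load o i ≤ κ.load o e + κ.top o i) :
    PEF1 (bundles o) κ.price := by
  intro i e
  rw [or_iff_not_imp_left, ← ne_eq, ← Finset.nonempty_iff_ne_empty]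
  intro hne
  obtain ⟨j, hj, hjt⟩ := κ.exists_price_eq_top hne
  refine ⟨j, hj, ?_⟩
  have := Finset.add_sum_erase _ κ.price hj
  have := h i e
  rw [load, load] at this
  linarith

theorem Balanced.load_le_add_hi (h : κ.Balanced o) (hi : 0 < count o κ.high i)
    (hr : κ.Reach o i e) : κ.load o i ≤ κ.load o e + κ.hi :=
  (h i e hr).trans_eq (by rw [top_of_pos hi])

theorem Balanced.count_le_add_one (h : κ.Balanced o) (hhi : 0 < κ.hi)
    (hi : κ.load o i = κ.hi * count o κ.high i) (he : κ.load o e = κ.hi * count o κ.high e)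
    (hr : κ.Reach o i e) : count o κ.high i ≤ count o κ.high e + 1 := by
  rcases Nat.eq_zero_or_pos (count o κ.high i) with h0 | h0
  · lia
  · have hle := h.load_le_add_hi h0 hr
    rw [hi, he] at hle
    have : κ.hi * (count o κ.high i : ℝ) ≤ κ.hi * (count o κ.high e + 1 : ℕ) := by
      push_cast
      linarith
    exact_mod_cast le_of_mul_le_mul_left this hhi

end Pricing

/-- The situation before any price is raised: `easy i j` says that chore `j` has the price `lo` for
agent `i`, and `home j` is the owner of a chore that is easy for somebody. The prices under
consideration are `lo ≤ hi`; they coincide if all costs do. -/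
structure Market (n m : ℕ) where
  easy : Fin n → Fin m → Prop
  home : Fin m → Fin n
  lo : ℝ
  hi : ℝ

namespace Market

variable {n m : ℕ}

/-- The chores that are easy for nobody. -/
def hard (M : Market n m) : Set (Fin m) := {j | ∀ i, ¬ M.easy i j}

/-- The number of chores that `i` owns before any price is raised. -/
noncomputable def homeCount (M : Market n m) (i : Fin n) : ℕ := count M.home M.hardᶜ i

/-- The pricing for distributing the chores that are easy for somebody. The other chores are left
aside for now, whence the price `0`. -/
def initial (M : Market n m) : Pricing n m where
  high := M.hardᶜ
  accepts := M.easy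
  lo := 0
  hi := M.hi

/-- The pricing in which, besides the hard chores, the chores of the agents in `C` are raised to the
high price. An agent in `C` accepts only chores that are easy for her. -/
def raised (M : Market n m) (C : Set (Fin n)) : Pricing n m where
  high := {j | j ∈ M.hard ∨ M.home j ∈ C}
  accepts e j := e ∉ C ∨ M.easy e j
  lo := M.lo
  hi := M.hi

/-- The conditions under which raising prices works. -/
structure Valid (M : Market n m) : Prop where
  lo_pos : 0 < M.lo
  lo_le_hi : M.lo ≤ M.hi
  easy_home : ∀ j ∉ M.hard, M.easy (M.home j) j
  balanced : M.initial.Balanced M.home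

/-- The agents with at least `τ` chores and those whom they can reach before any price is raised. -/
def layer (M : Market n m) (τ : ℕ) : Set (Fin n) :=
  {e | ∃ i, τ ≤ M.homeCount i ∧ M.initial.Reach M.home i e}

/-- `C` consists of the agents with at least `τ` chores and of agents with `τ - 1` chores, and
nobody outside `C` finds a chore of `C` easy. -/
structure IsLayer (M : Market n m) (τ : ℕ) (C : Set (Fin n)) : Prop where
  mem : ∀ i, τ ≤ M.homeCount i → i ∈ C
  closed : ∀ j ∉ M.hard, M.home j ∈ C → ∀ e, M.easy e j → e ∈ C
  le : ∀ i ∈ C, τ ≤ M.homeCount i + 1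

/-- `o` is a balanced allocation for the prices raised by `C`, and chores of low price are still
where they were. -/
structure IsStage (M : Market n m) (C : Set (Fin n)) (o : Fin m → Fin n) : Prop where
  fixed : ∀ j ∉ (M.raised C).high, o j = M.home j
  accepted : ∀ j ∈ (M.raised C).high, (M.raised C).accepts (o j) j
  balanced : (M.raised C).Balanced o

/-- Owners of chores of high price envy nobody up to one chore. -/
def Settled (M : Market n m) (C : Set (Fin n)) (o : Fin m → Fin n) : Prop :=
  ∀ i e, 0 < count o (M.raised C).high i →
    (M.raised C).load o i ≤ (M.raised C).load o e + M.hi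

/-- A settled stage for the threshold `τ + 1` which leaves some agent with so small a load that an
agent with `τ` chores of low price envies her. -/
structure IsEnvious (M : Market n m) (τ : ℕ) (C : Set (Fin n)) (o : Fin m → Fin n) : Prop where
  layer : M.IsLayer (τ + 1) C
  stage : M.IsStage C o
  settled : M.Settled C o
  poor : ∃ e, (M.raised C).load o e + M.lo < M.lo * τ

variable {M : Market n m} {C C' : Set (Fin n)} {o o' : Fin m → Fin n} {τ : ℕ} {i e f : Fin n}

theorem Valid.hi_pos (hM : M.Valid) : 0 < M.hi := hM.lo_pos.trans_le hM.lo_le_hi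

theorem Valid.load_nonneg (hM : M.Valid) : 0 ≤ (M.raised C).load o e :=
  Pricing.load_nonneg hM.lo_pos.le hM.hi_pos.le

theorem Valid.isLayer_layer (hM : M.Valid) (τ : ℕ) : M.IsLayer τ (M.layer τ) where
  mem i hi := ⟨i, hi, .refl⟩
  closed j hj := fun ⟨i, hi, hr⟩ e he => ⟨i, hi, hr.tail ⟨j, hj, rfl, he⟩⟩
  le := by
    rintro e ⟨i, hi, hr⟩
    refine hi.trans (hM.balanced.count_le_add_one hM.hi_pos ?_ ?_ hr) <;>
      rw [Pricing.load_eq, initial, zero_mul, add_zero]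

theorem IsLayer.notMem (hC : M.IsLayer τ C) (hi : M.homeCount i + 1 < τ) : i ∉ C := fun hiC =>
  hi.not_ge (hC.le i hiC)

namespace IsStage

theorem count_low_of_mem (h : M.IsStage C o) (hf : f ∈ C) :
    count o (M.raised C).highᶜ f = 0 :=
  count_eq_zero.2 fun j hj hjf => hj (Or.inr (by rwa [← h.fixed j hj, hjf]))

theorem count_low_of_notMem (h : M.IsStage C o) (hf : f ∉ C) :
    count o (M.raised C).highᶜ f = M.homeCount f := by
  refine count_congr fun j => ⟨?_, ?_⟩
  · rintro ⟨hj, hjH⟩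
    exact ⟨by rw [← h.fixed j hjH, hj], fun hu => hjH (Or.inl hu)⟩
  · rintro ⟨hj, hjU⟩
    have hjH : j ∉ (M.raised C).high := fun hh => hh.elim hjU fun hh => hf (hj ▸ hh)
    exact ⟨by rw [h.fixed j hjH, hj], hjH⟩

theorem load_of_mem (h : M.IsStage C o) (hf : f ∈ C) :
    (M.raised C).load o f = M.hi * count o (M.raised C).high f := by
  rw [Pricing.load_eq, h.count_low_of_mem hf, Nat.cast_zero, mul_zero, add_zero]
  rfl

theorem load_of_notMem (h : M.IsStage C o) (hf : f ∉ C) :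
    (M.raised C).load o f = M.hi * count o (M.raised C).high f + M.lo * M.homeCount f := by
  rw [Pricing.load_eq, h.count_low_of_notMem hf]
  rfl

theorem reach_of_notMem (hi : 0 < count o (M.raised C).high i) (he : e ∉ C) :
    (M.raised C).Reach o i e := by
  obtain ⟨j, hj, hji⟩ := count_pos.1 hi
  exact .single ⟨j, hj, hji, Or.inl he⟩

theorem settled_of_empty (h : M.IsStage C o) (hC : ∀ i, i ∉ C) : M.Settled C o := fun _ e hi =>
  h.balanced.load_le_add_hi hi (reach_of_notMem hi (hC e))

theorem load_add_lo_lt_of_envy (h : M.IsStage C o) (hM : M.Valid) (hC : M.IsLayer (τ + 1) C)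
    (hs : M.Settled C o)
    (henvy : (M.raised C).load o e + (M.raised C).top o i < (M.raised C).load o i) :
    (M.raised C).load o e + M.lo < M.lo * τ := by
  by_cases hi : 0 < count o (M.raised C).high i
  · rw [Pricing.top_of_pos hi] at henvy
    exact absurd (hs i e hi) henvy.not_ge
  · rw [Pricing.top_of_not_pos hi] at henvy
    change _ + M.lo < _ at henvy
    have h0 : count o (M.raised C).high i = 0 := by lia
    have hpos := hM.load_nonneg (C := C) (o := o) (e := e)
    by_cases hiC : i ∈ C
    · rw [h.load_of_mem hiC, h0, Nat.cast_zero, mul_zero] at henvy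
      linarith [hM.lo_pos]
    · rw [h.load_of_notMem hiC, h0, Nat.cast_zero, mul_zero, zero_add] at henvy
      have hle : M.homeCount i ≤ τ := by
        by_contra! hlt
        exact hiC (hC.mem i hlt)
      exact henvy.trans_le (by gcongr; exact hM.lo_pos.le)

theorem le_count_add_one_of_forall_reach (h : M.IsStage C o) (hM : M.Valid)
    (hC : M.IsLayer τ C) (hreach : ∀ f, (M.raised C).Reach o f e → f ∈ C) :
    τ ≤ count o (M.raised C).high e + 1 := by
  by_contra! hlt
  have hle : ∀ f, (M.raised C).Reach o f e → count o (M.raised C).high f ≤ M.homeCount f := by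
    intro f hf
    have := h.balanced.count_le_add_one hM.hi_pos (h.load_of_mem (hreach f hf))
      (h.load_of_mem (hreach e .refl)) hf
    have := hC.le f (hreach f hf)
    lia
  refine not_count_lt_of_forall_le (o := M.home) (S := M.hardᶜ) (o' := o)
    (R := {f | (M.raised C).Reach o f e}) (fun j hjU hj => ?_) hle (i := e) .refl ?_
  · have hjH : j ∈ (M.raised C).high := Or.inr (hreach _ hj)
    exact ⟨hjH, .head ⟨j, hjH, rfl, Or.inr (hM.easy_home j hjU)⟩ hj⟩
  · have := hC.le e (hreach e .refl)
    simp only [homeCount] at this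
    lia

end IsStage

namespace IsEnvious

theorem two_le (E : M.IsEnvious τ C' o') (hM : M.Valid) : 2 ≤ τ := by
  obtain ⟨e, he⟩ := E.poor
  have hlt : M.lo * 1 < M.lo * τ := by linarith [hM.load_nonneg (C := C') (o := o') (e := e)]
  exact_mod_cast lt_of_mul_lt_mul_left hlt hM.lo_pos.le

theorem load_lt (E : M.IsEnvious τ C' o') (hf : 0 < count o' (M.raised C').high f) :
    (M.raised C').load o' f + M.lo < M.lo * τ + M.hi := by
  obtain ⟨e, he⟩ := E.poor
  linarith [E.settled f e hf]

theorem count_lt_of_mem (E : M.IsEnvious τ C' o') (hM : M.Valid) (hf : f ∈ C') :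
    count o' (M.raised C').high f < τ := by
  have hτ := E.two_le hM
  rcases Nat.eq_zero_or_pos (count o' (M.raised C').high f) with h0 | h0
  · lia
  · have hlt := E.load_lt h0
    rw [E.stage.load_of_mem hf] at hlt
    have hτ' : (2 : ℝ) ≤ τ := by exact_mod_cast hτ
    have : M.hi * (count o' (M.raised C').high f : ℝ) < M.hi * τ := by
      nlinarith [hM.lo_pos, hM.lo_le_hi]
    exact_mod_cast lt_of_mul_lt_mul_left this hM.hi_pos.le

theorem homeCount_add_one_lt (E : M.IsEnvious τ C' o') (hM : M.Valid) (hf : f ∉ C')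
    (h0 : 0 < count o' (M.raised C').high f) : M.homeCount f + 1 < τ := by
  have hlt := E.load_lt h0
  rw [E.stage.load_of_notMem hf] at hlt
  have h1 : (1 : ℝ) ≤ count o' (M.raised C').high f := by exact_mod_cast h0
  have : M.lo * ((M.homeCount f + 1 : ℕ) : ℝ) < M.lo * τ := by
    push_cast
    nlinarith [hM.hi_pos]
  exact_mod_cast lt_of_mul_lt_mul_left this hM.lo_pos.le

theorem exists_homeCount_add_one_lt (E : M.IsEnvious τ C' o') (hM : M.Valid) :
    ∃ z, M.homeCount z + 1 < τ := by
  by_contra! hno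
  have hempty : ∀ f ∉ C', count o' (M.raised C').high f = 0 := by
    intro f hf
    by_contra hne
    exact (E.homeCount_add_one_lt hM hf (Nat.pos_of_ne_zero hne)).not_ge (hno f)
  have hlt : ∀ f ∈ C', count o' (M.raised C').high f < M.homeCount f := by
    intro f hf
    have := E.count_lt_of_mem hM hf
    have := E.layer.le f hf
    lia
  obtain ⟨e, he⟩ := E.poor
  have heC : e ∈ C' := by
    by_contra heC
    rw [E.stage.load_of_notMem heC, hempty e heC] at he
    have : (τ : ℝ) ≤ M.homeCount e + 1 := by exact_mod_cast hno e
    have := mul_le_mul_of_nonneg_left this hM.lo_pos.le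
    norm_num at he
    linarith
  refine not_count_lt_of_forall_le (R := C') (fun j _ hj => ?_) (fun f hf => (hlt f hf).le) heC
    (hlt e heC)
  have hjH : j ∈ (M.raised C').high := Or.inr hj
  refine ⟨hjH, ?_⟩
  by_contra hn
  exact count_eq_zero.1 (hempty _ hn) j hjH rfl

variable (E : M.IsEnvious τ C' o') (hC : M.IsLayer τ C)

include E hC

theorem subset : C' ⊆ C := fun f hf => hC.mem f (by have := E.layer.le f hf; lia)

theorem high_subset : (M.raised C').high ⊆ (M.raised C).high := fun _ hj =>
  hj.imp id fun h => E.subset hC h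

theorem count_high_eq_zero (hM : M.Valid) (hf : f ∈ C) (hf' : f ∉ C') :
    count o' (M.raised C').high f = 0 := by
  by_contra hne
  exact (E.homeCount_add_one_lt hM hf' (Nat.pos_of_ne_zero hne)).not_ge (hC.le f hf)

theorem count_high_eq (hf : f ∈ C → f ∈ C') :
    count o' (M.raised C).high f = count o' (M.raised C').high f := by
  refine count_congr fun j => and_congr_right fun hj => ⟨fun hjH => ?_, fun h => E.high_subset hC h⟩
  by_contra hjH'
  have hhome : M.home j = f := by rw [← E.stage.fixed j hjH', hj]
  have hjC : M.home j ∈ C := hjH.resolve_left fun hu => hjH' (Or.inl hu)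
  exact hjH' (Or.inr (hhome ▸ hf (hhome ▸ hjC)))

theorem count_high_eq_homeCount (hM : M.Valid) (hf : f ∈ C) (hf' : f ∉ C') :
    count o' (M.raised C).high f = M.homeCount f := by
  rw [← E.stage.count_low_of_notMem hf']
  refine count_congr fun j => and_congr_right fun hj => ⟨fun _ hjH => ?_, fun hjH => Or.inr ?_⟩
  · exact count_eq_zero.1 (E.count_high_eq_zero hC hM hf hf') j hjH hj
  · rwa [← E.stage.fixed j hjH, hj]

theorem easy_of_mem (hM : M.Valid) {j : Fin m} (hj : o' j ∈ C) : M.easy (o' j) j := by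
  by_cases hj' : o' j ∈ C'
  · have hjH : j ∈ (M.raised C').high := by
      by_contra hjH
      exact count_eq_zero.1 (E.stage.count_low_of_mem hj') j hjH rfl
    exact (E.stage.accepted j hjH).resolve_left (not_not.2 hj')
  · have hjH : j ∉ (M.raised C').high := fun hjH =>
      count_eq_zero.1 (E.count_high_eq_zero hC hM hj hj') j hjH rfl
    rw [E.stage.fixed j hjH]
    exact hM.easy_home j fun hu => hjH (Or.inl hu)

theorem count_add_le (hM : M.Valid) (h : M.IsStage C o) {d k : ℕ} (hd : τ ≤ d + 1)
    (hf : M.hi * (d + k) < (M.raised C).load o f) (hk : k ≤ count o (M.raised C).high f) :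
    count o' (M.raised C).high f + k ≤ count o (M.raised C).high f := by
  by_cases hfC : f ∈ C
  · rw [h.load_of_mem hfC] at hf
    have hlt : d + k < count o (M.raised C).high f := by
      exact_mod_cast lt_of_mul_lt_mul_left hf hM.hi_pos.le
    have hle : count o' (M.raised C).high f ≤ τ := by
      by_cases hfC' : f ∈ C'
      · rw [E.count_high_eq hC fun _ => hfC']
        exact (E.count_lt_of_mem hM hfC').le
      · rw [E.count_high_eq_homeCount hC hM hfC hfC']
        by_contra! hlt
        exact hfC' (E.layer.mem f hlt)
    lia
  · rw [h.load_of_notMem hfC] at hf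
    rw [E.count_high_eq hC fun h => absurd h hfC]
    rcases Nat.eq_zero_or_pos (count o' (M.raised C').high f) with h0 | h0
    · lia
    · have hlt := E.load_lt h0
      rw [E.stage.load_of_notMem fun hf' => hfC (E.subset hC hf')] at hlt
      have hτ : M.lo * τ ≤ M.hi * d + M.lo := by
        have : (τ : ℝ) ≤ d + 1 := by exact_mod_cast hd
        nlinarith [hM.lo_pos, mul_le_mul_of_nonneg_right hM.lo_le_hi (Nat.cast_nonneg (α := ℝ) d)]
      have : M.hi * ((count o' (M.raised C').high f + k : ℕ) : ℝ) <
          M.hi * ((count o (M.raised C).high f + 1 : ℕ) : ℝ) := by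
        push_cast
        linarith
      have : count o' (M.raised C').high f + k < count o (M.raised C).high f + 1 := by
        exact_mod_cast lt_of_mul_lt_mul_left this hM.hi_pos.le
      lia

/-- If `i` envied `e` in the new stage, then every agent reachable from `i`, to whom alone the old
owners could have passed their chores, would have gained chores of high price, and `i` strictly. -/
theorem settled_next (hM : M.Valid) (h : M.IsStage C o) : M.Settled C o := by
  intro i e hi
  by_contra! henvy
  have hunreach : ∀ f, ¬ (M.raised C).Reach o i f → f ∈ C := fun f hf => by
    by_contra hfC
    exact hf (IsStage.reach_of_notMem hi hfC)
  have hie : ¬ (M.raised C).Reach o i e := fun hr =>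
    henvy.not_ge (h.balanced.load_le_add_hi hi hr)
  have hd := h.le_count_add_one_of_forall_reach hM hC fun f hf =>
    hunreach f fun hr => hie (hr.trans hf)
  rw [h.load_of_mem (hunreach e hie)] at henvy
  have hgain : ∀ f, (M.raised C).Reach o i f →
      count o' (M.raised C).high f ≤ count o (M.raised C).high f := fun f hf => by
    have hle : (M.raised C).load o i ≤ (M.raised C).load o f + M.hi :=
      h.balanced.load_le_add_hi hi hf
    exact E.count_add_le hC hM h hd (k := 0) (by push_cast; linarith) (Nat.zero_le _)
  refine not_count_lt_of_forall_le (R := {f | (M.raised C).Reach o i f})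
    (fun j hjH hj => ⟨hjH, ?_⟩) hgain (i := i) .refl
    (E.count_add_le hC hM h hd (k := 1) (by push_cast; linarith) hi)
  by_contra hn
  exact hn (hj.tail ⟨j, hjH, rfl, Or.inr (E.easy_of_mem hC hM (hunreach _ hn))⟩)

end IsEnvious

end Market

section BangPerBuck

variable {n m : ℕ} {c : Fin n → Fin m → ℝ} {M : Market n m} {C : Set (Fin n)} {o : Fin m → Fin n}
  {τ : ℕ} {i : Fin n} {j l : Fin m}

/-- A chore is easy for an agent if she has no cheaper one. -/
def Easy (c : Fin n → Fin m → ℝ) (i : Fin n) (j : Fin m) : Prop := ∀ l, c i j ≤ c i l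

/-- All costs are `lo` or `hi`. -/
def Bivalued (c : Fin n → Fin m → ℝ) (lo hi : ℝ) : Prop := ∀ i j, c i j = lo ∨ c i j = hi

theorem Bivalued.lo_le {lo hi : ℝ} (hc : Bivalued c lo hi) (h : lo ≤ hi) (i : Fin n) (j : Fin m) :
    lo ≤ c i j := by
  rcases hc i j with h' | h' <;> rw [h']
  exact h

theorem Bivalued.eq_of_not_easy {lo hi : ℝ} (hc : Bivalued c lo hi) (h : lo ≤ hi)
    (hj : ¬ Easy c i j) : c i j = hi ∧ ∀ l, Easy c i l → c i l = lo := by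
  simp only [Easy, not_forall, not_le] at hj
  obtain ⟨l, hl⟩ := hj
  have hj' : c i j = hi := (hc i j).resolve_left ((hc.lo_le h i l).trans_lt hl).ne'
  have hl' : c i l = lo := (hc i l).resolve_right (hl.trans_eq hj').ne
  exact ⟨hj', fun l' he => le_antisymm (hl' ▸ he l) (hc.lo_le h i l')⟩

namespace Market

theorem Valid.price_pos (hM : M.Valid) (j : Fin m) : 0 < (M.raised C).price j := by
  rw [Pricing.price]
  split_ifs
  exacts [hM.hi_pos, hM.lo_pos]

theorem Valid.price_le (hM : M.Valid) (j : Fin m) : (M.raised C).price j ≤ M.hi := by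
  rw [Pricing.price]
  split_ifs
  exacts [le_rfl, hM.lo_le_hi]

theorem IsLayer.not_easy (hC : M.IsLayer τ C) (hi : i ∉ C) (hj : j ∈ (M.raised C).high) :
    ¬ M.easy i j := fun he => by
  have hjU : j ∉ M.hard := fun hu => hu i he
  exact hi (hC.closed j hjU (hj.resolve_left hjU) i he)

theorem IsLayer.price_le_cost (hC : M.IsLayer τ C) (hM : M.Valid) (hc : Bivalued c M.lo M.hi)
    (he : M.easy = Easy c) (hi : i ∉ C) (j : Fin m) : (M.raised C).price j ≤ c i j := by
  by_cases hj : j ∈ (M.raised C).high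
  · exact (Pricing.price_of_mem hj).trans_le
      (hc.eq_of_not_easy hM.lo_le_hi (he ▸ hC.not_easy hi hj)).1.ge
  · exact (Pricing.price_of_notMem hj).trans_le (hc.lo_le hM.lo_le_hi i j)

theorem IsLayer.price_eq_cost (hC : M.IsLayer τ C) (hM : M.Valid) (hc : Bivalued c M.lo M.hi)
    (he : M.easy = Easy c) (hi : i ∉ C) (hl : l ∈ (M.raised C).high)
    (hj : j ∈ (M.raised C).high ∨ M.easy i j) : (M.raised C).price j = c i j := by
  have hval := fun {l} hl => hc.eq_of_not_easy hM.lo_le_hi (he ▸ hC.not_easy hi (j := l) hl)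
  by_cases hjH : j ∈ (M.raised C).high
  · exact (Pricing.price_of_mem hjH).trans (hval hjH).1.symm
  · exact (Pricing.price_of_notMem hjH).trans
      ((hval hl).2 j (he ▸ hj.resolve_left hjH)).symm

theorem IsStage.easy_of_mem (h : M.IsStage C o) (hj : o j ∈ C) :
    j ∈ (M.raised C).high ∧ M.easy (o j) j := by
  have hjH : j ∈ (M.raised C).high := by
    by_contra hjH
    exact count_eq_zero.1 (h.count_low_of_mem hj) j hjH rfl
  exact ⟨hjH, (h.accepted j hjH).resolve_left (not_not.2 hj)⟩

theorem IsStage.easy_of_notMem (h : M.IsStage C o) (hM : M.Valid)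
    (hj : j ∉ (M.raised C).high) : M.easy (o j) j := by
  rw [h.fixed j hj]
  exact hM.easy_home j fun hu => hj (Or.inl hu)

theorem IsStage.onMBB (h : M.IsStage C o) (hM : M.Valid) (hC : M.IsLayer τ C)
    (hc : Bivalued c M.lo M.hi) (he : M.easy = Easy c) :
    OnMBB c (bundles o) (M.raised C).price := by
  intro i j hj j'
  obtain rfl : o j = i := mem_bundles.1 hj
  have hcpos : ∀ l, 0 < c (o j) l := fun l => hM.lo_pos.trans_le (hc.lo_le hM.lo_le_hi _ l)
  rw [div_le_div_iff₀ (hM.price_pos j) (hM.price_pos j')]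
  by_cases hiC : o j ∈ C
  · obtain ⟨hjH, heasy⟩ := h.easy_of_mem hiC
    rw [he] at heasy
    rw [Pricing.price_of_mem hjH]
    exact mul_le_mul (heasy j') (hM.price_le j') (hM.price_pos j').le (hcpos j').le
  have hown : j ∈ (M.raised C).high ∨ M.easy (o j) j :=
    or_iff_not_imp_left.2 (h.easy_of_notMem hM)
  by_cases hhigh : ∃ l, l ∈ (M.raised C).high
  · obtain ⟨l, hl⟩ := hhigh
    rw [hC.price_eq_cost hM hc he hiC hl hown, mul_comm]
    exact mul_le_mul_of_nonneg_right (hC.price_le_cost hM hc he hiC j') (hcpos j).le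
  · have hlow : ∀ l, (M.raised C).price l = M.lo := fun l =>
      Pricing.price_of_notMem (not_exists.1 hhigh l)
    rw [hlow, hlow]
    have heasy : Easy c (o j) j := he ▸ hown.resolve_left (not_exists.1 hhigh j)
    exact mul_le_mul_of_nonneg_right (heasy j') hM.lo_pos.le

end Market

end BangPerBuck

section Memory

/-- The names of the arrays that the program uses. The first two are the input and the output array
of the machine. -/
inductive Arr where
  | input | owner | home | easy | hard | normal | high | everyone | closed | mark | target | parent
  | via | count | load | net | lo | hi | zero | cut | source | row | col | pos | found | foundRow
  | foundCol | idle
  deriving DecidableEq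

/-- The number by which the machine addresses an array. -/
def Arr.code (A : Arr) : ℕ := A.ctorIdx

theorem Arr.code_inj {A B : Arr} : A.code = B.code ↔ A = B :=
  ⟨fun h => (Arr.ofNat_ctorIdx A).symm.trans ((congrArg Arr.ofNat h).trans (Arr.ofNat_ctorIdx B)),
    congrArg Arr.code⟩

/-- The content of the index cell `A[i, j]`. -/
def ix (s : State) (A : Arr) (i j : ℕ) : ℕ := s.idx (A.code, i, j)

/-- The content of the number cell `A[i, j]`. -/
def nm (s : State) (A : Arr) (i j : ℕ) : ℝ := s.num (A.code, i, j)

/-- The memory after writing `v` to the index cell `A[i, j]`. -/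
def setIx (s : State) (A : Arr) (i j v : ℕ) : State :=
  { s with idx := Function.update s.idx (A.code, i, j) v }

/-- The memory after writing `y` to the number cell `A[i, j]`. -/
def setNm (s : State) (A : Arr) (i j : ℕ) (y : ℝ) : State :=
  { s with num := Function.update s.num (A.code, i, j) y }

variable (s : State) (A B : Arr) (i j k l v : ℕ) (y : ℝ)

@[simp]
theorem ix_setIx :
    ix (setIx s A i j v) B k l = if B = A ∧ k = i ∧ l = j then v else ix s B k l := by
  simp only [ix, setIx, Function.update_apply, Prod.mk.injEq, Arr.code_inj]

@[simp]
theorem nm_setNm :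
    nm (setNm s A i j y) B k l = if B = A ∧ k = i ∧ l = j then y else nm s B k l := by
  simp only [nm, setNm, Function.update_apply, Prod.mk.injEq, Arr.code_inj]

@[simp]
theorem ix_setNm : ix (setNm s A i j y) B k l = ix s B k l := rfl

@[simp]
theorem nm_setIx : nm (setIx s A i j v) B k l = nm s B k l := rfl

/-- The memories `s` and `t` agree outside the arrays with codes in `W`. -/
def Frame (W : List ℕ) (s t : State) : Prop :=
  ∀ A : Arr, A.code ∉ W → ∀ i j, ix t A i j = ix s A i j ∧ nm t A i j = nm s A i j

end Memory

namespace Frame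

variable {W W' V : List ℕ} {s t u : State} {A : Arr} {i j v : ℕ} {y : ℝ}

theorem refl (W : List ℕ) (s : State) : Frame W s s := fun _ _ _ _ => ⟨rfl, rfl⟩

theorem trans (h : Frame W s t) (h' : Frame W' t u) (hW : W ⊆ V) (hW' : W' ⊆ V) : Frame V s u :=
  fun A hA i j =>
    have hA' := h' A (fun hm => hA (hW' hm)) i j
    have hA := h A (fun hm => hA (hW hm)) i j
    ⟨hA'.1.trans hA.1, hA'.2.trans hA.2⟩

theorem mono (h : Frame W s t) (hW : W ⊆ V) : Frame V s t :=
  h.trans (refl W t) hW hW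

theorem setIx_right (h : Frame W s t) (hA : A.code ∈ W) : Frame W s (setIx t A i j v) :=
  fun B hB k l => by
    have hne : B ≠ A := by
      rintro rfl
      exact hB hA
    simpa [hne] using h B hB k l

theorem setNm_right (h : Frame W s t) (hA : A.code ∈ W) : Frame W s (setNm t A i j y) :=
  fun B hB k l => by
    have hne : B ≠ A := by
      rintro rfl
      exact hB hA
    simpa [hne] using h B hB k l

theorem ix_eq (h : Frame W s t) (A : Arr) (hA : A.code ∉ W := by decide) :
    ix t A i j = ix s A i j := (h A hA i j).1

theorem nm_eq (h : Frame W s t) (A : Arr) (hA : A.code ∉ W := by decide) :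
    nm t A i j = nm s A i j := (h A hA i j).2

end Frame

section Expressions

/-- The cell `A[e, f]`. -/
def cell (A : Arr) (e f : IExpr) : Cell := ⟨A.code, e, f⟩

/-- The cell `A[0, e]`. -/
abbrev entry (A : Arr) (e : IExpr) : Cell := cell A (.const 0) e

/-- The cell `A[0, 0]`. -/
abbrev var (A : Arr) : Cell := entry A (.const 0)

/-- The content of the index cell `A[e, f]`, as an expression. -/
def get (A : Arr) (e f : IExpr) : IExpr := .read A.code e f

/-- The content of the index cell `A[0, e]`, as an expression. -/
abbrev elem (A : Arr) (e : IExpr) : IExpr := get A (.const 0) e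

/-- The content of the index cell `A[0, 0]`, as an expression. -/
abbrev val (A : Arr) : IExpr := elem A (.const 0)

/-- The number of agents (`d = 0`) or of chores (`d = 1`), as an expression. -/
abbrev dim (d : ℕ) : IExpr := elem .input (.const d)

/-- The test whether an index is nonzero. Flags are stored as indices, with every positive number
standing for truth. -/
def isSet (e : IExpr) : Test := .leIdx (.const 1) e

/-- The test whether one index is less than another. -/
def ltIdx (e f : IExpr) : Test := .neg (.leIdx f e)

/-- The test whether one number is less than another. -/
def ltNum (u v : Cell) : Test := .neg (.leNum v u)

variable {s : State} {A : Arr} {e f : IExpr} {k : ℕ} {u v : Cell}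

@[simp]
theorem index_eval_const : (IExpr.const k).eval s = k := rfl

@[simp]
theorem index_eval_add : (IExpr.add e f).eval s = e.eval s + f.eval s := rfl

@[simp]
theorem index_eval_sub : (IExpr.sub e f).eval s = e.eval s - f.eval s := rfl

@[simp]
theorem index_eval_get : (get A e f).eval s = ix s A (e.eval s) (f.eval s) := rfl

/-- The content of a number cell. -/
def content (s : State) (u : Cell) : ℝ := s.num (u.addr s)

@[simp]
theorem content_cell : content s (cell A e f) = nm s A (e.eval s) (f.eval s) := rfl

@[simp]
theorem holds_isSet : (isSet e).Holds s ↔ 0 < e.eval s := Iff.rfl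

@[simp]
theorem holds_ltIdx : (ltIdx e f).Holds s ↔ e.eval s < f.eval s := not_le

@[simp]
theorem holds_ltNum : (ltNum u v).Holds s ↔ content s u < content s v := not_le

@[simp]
theorem holds_neg {b : Test} : (Test.neg b).Holds s ↔ ¬ b.Holds s := Iff.rfl

@[simp]
theorem holds_conj {b d : Test} : (Test.conj b d).Holds s ↔ b.Holds s ∧ d.Holds s := Iff.rfl

end Expressions

section Programs

open Polynomial

/-- The total-correctness predicate transformer of programs: from `s`, every loop of `P` ends after
at most `N` rounds, every arithmetic operation has a result satisfying `G`, and the final state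
satisfies `Q`. For a loop this asks for an invariant with a variant that decreases in every round
from at most `N`. -/
def wp (N : ℕ) (G : ℝ → Prop) : Prog → (State → Prop) → State → Prop
  | .setIdx r e, Q, s => Q { s with idx := Function.update s.idx (r.addr s) (e.eval s) }
  | .setNum r op, Q, s =>
    ∃ y, op.Result s y ∧ G y ∧ Q { s with num := Function.update s.num (r.addr s) y }
  | .seq P R, Q, s => wp N G P (wp N G R Q) s
  | .branch b P R, Q, s => (b.Holds s → wp N G P Q s) ∧ (¬ b.Holds s → wp N G R Q s)
  | .loop b P, Q, s => ∃ I : ℕ → State → Prop, (∃ v ≤ N, I v s) ∧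
      ∀ v t, I v t → (b.Holds t → wp N G P (fun u => ∃ v' < v, I v' u) t) ∧ (¬ b.Holds t → Q t)

/-- The arrays that a program may write. -/
def writes : Prog → List ℕ
  | .setIdx r _ => [r.A]
  | .setNum r _ => [r.A]
  | .seq P R => writes P ++ writes R
  | .branch _ P R => writes P ++ writes R
  | .loop _ P => writes P

/-- A bound on the number of steps of a program in terms of a bound on the numbers of rounds of its
loops. -/
noncomputable def timeBound : Prog → ℕ[X]
  | .setIdx r e => C (r.cost + e.cost)
  | .setNum r op => C (r.cost + op.cost)
  | .seq P R => timeBound P + timeBound R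
  | .branch b P R => C b.cost + timeBound P + timeBound R
  | .loop b P => X * (C b.cost + timeBound P) + C b.cost

variable {N : ℕ} {G : ℝ → Prop} {P R : Prog} {Q Q' : State → Prop} {s : State} {b : Test}

theorem wp_mono (h : wp N G P Q s) (hQ : ∀ t, Q t → Q' t) : wp N G P Q' s := by
  induction P generalizing Q Q' s with
  | setIdx r e => exact hQ _ h
  | setNum r op =>
    obtain ⟨y, hy, hG, h⟩ := h
    exact ⟨y, hy, hG, hQ _ h⟩
  | seq P R ihP ihR => exact ihP h fun t ht => ihR ht hQ
  | branch b P R ihP ihR => exact ⟨fun hb => ihP (h.1 hb) hQ, fun hb => ihR (h.2 hb) hQ⟩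
  | loop b P _ =>
    obtain ⟨I, h0, h⟩ := h
    exact ⟨I, h0, fun v t ht => ⟨(h v t ht).1, fun hb => hQ t ((h v t ht).2 hb)⟩⟩

theorem exists_exec_loop {T : ℕ} {I : ℕ → State → Prop}
    (hI : ∀ v t, I v t → (b.Holds t → ∃ k L u, Exec P t k L u ∧ k ≤ T ∧ (∀ y ∈ L, G y) ∧
      ∃ v' < v, I v' u) ∧ (¬ b.Holds t → Q t)) (v : ℕ) (h : I v s) :
    ∃ k L u, Exec (.loop b P) s k L u ∧ k ≤ v * (b.cost + T) + b.cost ∧ (∀ y ∈ L, G y) ∧ Q u := by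
  induction v using Nat.strong_induction_on generalizing s with
  | _ v ih =>
    by_cases hb : b.Holds s
    · obtain ⟨k₁, L₁, s₁, hexec₁, hk₁, hL₁, v', hv', h₁⟩ := (hI v s h).1 hb
      obtain ⟨k₂, L₂, s₂, hexec₂, hk₂, hL₂, hQ⟩ := ih v' hv' h₁
      refine ⟨_, _, s₂, .loopTrue hb hexec₁ hexec₂, ?_, ?_, hQ⟩
      · calc b.cost + k₁ + k₂ ≤ b.cost + T + (v' * (b.cost + T) + b.cost) := by gcongr
          _ = (v' + 1) * (b.cost + T) + b.cost := by ring
          _ ≤ v * (b.cost + T) + b.cost := by gcongr; exact hv'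
      · exact List.forall_mem_append.2 ⟨hL₁, hL₂⟩
    · exact ⟨_, _, s, .loopFalse hb, Nat.le_add_left _ _, by simp, (hI v s h).2 hb⟩

theorem exists_exec_of_wp (h : wp N G P Q s) :
    ∃ t L u, Exec P s t L u ∧ t ≤ (timeBound P).eval N ∧ (∀ y ∈ L, G y) ∧ Q u := by
  induction P generalizing Q s with
  | setIdx r e => exact ⟨_, _, _, .setIdx r e s, by simp [timeBound], by simp, h⟩
  | setNum r op =>
    obtain ⟨y, hy, hG, h⟩ := h
    exact ⟨_, _, _, .setNum r op s y hy, by simp [timeBound], by simpa using hG, h⟩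
  | seq P R ihP ihR =>
    obtain ⟨t₁, L₁, s₁, hexec₁, ht₁, hL₁, h₁⟩ := ihP h
    obtain ⟨t₂, L₂, s₂, hexec₂, ht₂, hL₂, h₂⟩ := ihR h₁
    refine ⟨_, _, s₂, .seq hexec₁ hexec₂, ?_, List.forall_mem_append.2 ⟨hL₁, hL₂⟩, h₂⟩
    simp only [timeBound, eval_add]
    lia
  | branch b P R ihP ihR =>
    by_cases hb : b.Holds s
    · obtain ⟨t, L, u, hexec, ht, hL, hQ⟩ := ihP (h.1 hb)
      refine ⟨_, L, u, .branchTrue hb hexec, ?_, hL, hQ⟩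
      simp only [timeBound, eval_add, eval_C]
      lia
    · obtain ⟨t, L, u, hexec, ht, hL, hQ⟩ := ihR (h.2 hb)
      refine ⟨_, L, u, .branchFalse hb hexec, ?_, hL, hQ⟩
      simp only [timeBound, eval_add, eval_C]
      lia
  | loop b P ih =>
    obtain ⟨I, ⟨v, hv, h0⟩, hI⟩ := h
    obtain ⟨t, L, u, hexec, ht, hL, hQ⟩ := exists_exec_loop (T := (timeBound P).eval N)
      (fun v t ht => ⟨fun hb => ih ((hI v t ht).1 hb), (hI v t ht).2⟩) v h0
    refine ⟨t, L, u, hexec, ht.trans ?_, hL, hQ⟩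
    simp only [timeBound, eval_add, eval_mul, eval_X, eval_C]
    gcongr

theorem wp_frame (h : wp N G P Q s) : wp N G P (fun t => Frame (writes P) s t ∧ Q t) s := by
  induction P generalizing Q s with
  | setIdx r e =>
    refine ⟨fun A hA i j => ?_, h⟩
    have hA : A.code ≠ r.A := by simpa [writes] using hA
    simp [ix, nm, Cell.addr, hA]
  | setNum r op =>
    obtain ⟨y, hy, hG, h⟩ := h
    refine ⟨y, hy, hG, fun A hA i j => ?_, h⟩
    have hA : A.code ≠ r.A := by simpa [writes] using hA
    simp [ix, nm, Cell.addr, hA]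
  | seq P R ihP ihR =>
    refine wp_mono (P := P) (ihP h) fun t ht => wp_mono (ihR ht.2) fun u hu => ⟨?_, hu.2⟩
    exact ht.1.trans hu.1 (List.subset_append_left _ _) (List.subset_append_right _ _)
  | branch b P R ihP ihR =>
    exact ⟨fun hb => wp_mono (ihP (h.1 hb)) fun t ht =>
        ⟨ht.1.mono (List.subset_append_left _ _), ht.2⟩,
      fun hb => wp_mono (ihR (h.2 hb)) fun t ht =>
        ⟨ht.1.mono (List.subset_append_right _ _), ht.2⟩⟩
  | loop b P ih =>
    obtain ⟨I, ⟨v, hv, h0⟩, hI⟩ := h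
    refine ⟨fun v t => I v t ∧ Frame (writes P) s t, ⟨v, hv, h0, .refl _ _⟩, fun v t ht =>
      ⟨fun hb => wp_mono (ih ((hI v t ht.1).1 hb)) ?_, fun hb => ⟨ht.2, (hI v t ht.1).2 hb⟩⟩⟩
    rintro u ⟨hu, v', hv', h'⟩
    exact ⟨v', hv', h', ht.2.trans hu (List.Subset.refl _) (List.Subset.refl _)⟩

theorem wp_bind (h : wp N G P Q' s) (hQ : ∀ t, Frame (writes P) s t → Q' t → Q t) :
    wp N G P Q s :=
  wp_mono (wp_frame h) fun t ht => hQ t ht.1 ht.2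

theorem wp_loop (I : ℕ → State → Prop) (v : ℕ) (hv : v ≤ N) (h0 : I v s)
    (hI : ∀ v t, Frame (writes P) s t → I v t → b.Holds t →
      wp N G P (fun u => ∃ v' < v, I v' u) t)
    (hQ : ∀ v t, Frame (writes P) s t → I v t → ¬ b.Holds t → Q t) : wp N G (.loop b P) Q s := by
  refine ⟨fun v t => I v t ∧ Frame (writes P) s t, ⟨v, hv, h0, .refl _ _⟩, fun v t ht =>
    ⟨fun hb => wp_bind (hI v t ht.2 ht.1 hb) ?_, hQ v t ht.2 ht.1⟩⟩
  rintro u hu ⟨v', hv', h'⟩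
  exact ⟨v', hv', h', ht.2.trans hu (List.Subset.refl _) (List.Subset.refl _)⟩

infixr:30 ";;" => Prog.seq

/-- The machine has no empty program. This one writes to a cell that is never read. -/
def skip : Prog := .setIdx (var .idle) (.const 0)

/-- The program that runs `P` for all values of the variable `K` below the `d`-th dimension of the
instance. -/
def forLoop (K : Arr) (d : ℕ) (P : Prog) : Prog :=
  .setIdx (var K) (.const 0) ;;
  .loop (ltIdx (val K) (dim d)) (P ;; .setIdx (var K) (.add (val K) (.const 1)))

/-- The program that fills the array `A` with the values of the expression `g` in the variable
`pos`. -/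
def fill (A : Arr) (d : ℕ) (g : IExpr) : Prog :=
  forLoop .pos d (.setIdx (entry A (val .pos)) g)

/-- The program that searches for a value of the variable `pos` with the property `b`. -/
def find (d : ℕ) (b : Test) : Prog :=
  .setIdx (var .found) (dim d) ;;
  forLoop .pos d (.branch b (.setIdx (var .found) (val .pos)) skip)

/-- The program that searches for an agent `row` and a value of the variable `col` with the property
`b`. -/
def findPair (d : ℕ) (b : Test) : Prog :=
  .setIdx (var .foundRow) (dim 0) ;;
  forLoop .row 0 (forLoop .col d
    (.branch b (.setIdx (var .foundRow) (val .row) ;; .setIdx (var .foundCol) (val .col)) skip))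

variable {A K : Arr} {e f g : IExpr} {u v : Cell} {d n m : ℕ}

@[simp]
theorem wp_seq : wp N G (P ;; R) Q s ↔ wp N G P (wp N G R Q) s := Iff.rfl

@[simp]
theorem wp_setIdx : wp N G (.setIdx (cell A e f) g) Q s ↔
    Q (setIx s A (e.eval s) (f.eval s) (g.eval s)) := Iff.rfl

@[simp]
theorem wp_branch : wp N G (.branch b P R) Q s ↔
    (b.Holds s → wp N G P Q s) ∧ (¬ b.Holds s → wp N G R Q s) := Iff.rfl

@[simp]
theorem wp_copy : wp N G (.setNum (cell A e f) (.copy u)) Q s ↔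
    G (content s u) ∧ Q (setNm s A (e.eval s) (f.eval s) (content s u)) := by
  simp [wp, NumOp.Result, content, setNm, cell, Cell.addr]

@[simp]
theorem wp_add : wp N G (.setNum (cell A e f) (.add u v)) Q s ↔
    G (content s u + content s v) ∧
      Q (setNm s A (e.eval s) (f.eval s) (content s u + content s v)) := by
  simp [wp, NumOp.Result, content, setNm, cell, Cell.addr]

@[simp]
theorem wp_sub : wp N G (.setNum (cell A e f) (.sub u v)) Q s ↔
    G (content s u - content s v) ∧
      Q (setNm s A (e.eval s) (f.eval s) (content s u - content s v)) := by
  simp [wp, NumOp.Result, content, setNm, cell, Cell.addr]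

@[simp]
theorem wp_zero : wp N G (.setNum (cell A e f) (.const 0)) Q s ↔
    G 0 ∧ Q (setNm s A (e.eval s) (f.eval s) 0) := by
  simp [wp, NumOp.Result, setNm, cell, Cell.addr]

theorem wp_forLoop (I : ℕ → State → Prop) (hd : ix s .input 0 d = n) (hN : n ≤ N)
    (h0 : I 0 s) (hI : ∀ k t v, I k t → I k (setIx t K 0 0 v))
    (hstep : ∀ k < n, ∀ t, Frame (K.code :: writes P) s t → ix t K 0 0 = k → I k t →
      wp N G P (I (k + 1)) t)
    (hP : K.code ∉ writes P := by decide)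
    (hinput : Arr.input.code ∉ K.code :: writes P := by decide) :
    wp N G (forLoop K d P) (I n) s := by
  have hdim : ∀ {t}, Frame (K.code :: writes P) s t → ix t .input 0 d = n := fun ht =>
    (ht.ix_eq _ hinput).trans hd
  have hframe : ∀ {t}, Frame (writes (.loop (ltIdx (val K) (dim d))
      (P ;; .setIdx (var K) (.add (val K) (.const 1))))) (setIx s K 0 0 0) t →
      Frame (K.code :: writes P) s t := fun ht =>
    ((Frame.refl [K.code] s).setIx_right (by simp)).trans ht (by simp)
      (by simp [writes, cell])
  refine wp_seq.2 (wp_setIdx.2 (wp_loop (fun v t => ∃ k ≤ n, v = n - k ∧ ix t K 0 0 = k ∧ I k t)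
    n hN ⟨0, n.zero_le, by simp, by simp, hI _ _ _ h0⟩ ?_ ?_))
  · rintro v t ht ⟨k, hk, rfl, hKk, h⟩ hb
    have hlt : k < n := by simpa [hKk, hdim (hframe ht)] using hb
    refine wp_seq.2 (wp_bind (hstep k hlt t (hframe ht) hKk h) fun u hu h' => wp_setIdx.2 ?_)
    exact ⟨n - (k + 1), by lia, k + 1, hlt, rfl, by simp [hu.ix_eq K hP, hKk], hI _ _ _ h'⟩
  · rintro v t ht ⟨k, hk, rfl, hKk, h⟩ hb
    have hge : n ≤ k := by simpa [hKk, hdim (hframe ht)] using hb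
    exact hk.antisymm hge ▸ h

theorem wp_fill {f : Fin n → ℕ} (hd : ix s .input 0 d = n) (hN : n ≤ N)
    (hg : ∀ (k : Fin n) t, Frame [A.code, Arr.pos.code] s t → ix t .pos 0 0 = k → g.eval t = f k)
    (hA : A ≠ .pos := by decide) (hinput : A ≠ .input := by decide) :
    wp N G (fill A d g) (fun t => ∀ k : Fin n, ix t A 0 k = f k) s := by
  refine wp_mono (wp_forLoop (fun l t => ∀ k : Fin n, (k : ℕ) < l → ix t A 0 k = f k) hd hN
    (by simp) ?_ ?_ (by simpa [writes, cell, Arr.code_inj] using hA.symm)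
    (by simpa [writes, cell, Arr.code_inj] using hinput.symm)) fun t ht k => ht k k.2
  · intro k t v h l hl
    simpa [hA] using h l hl
  · intro k hk t ht hKk h
    refine wp_setIdx.2 fun l hl => ?_
    rcases Nat.lt_succ_iff_lt_or_eq.1 hl with hl | rfl
    · simpa [hKk, hl.ne] using h l hl
    · simpa [hKk] using hg l t (ht.mono (by simp [writes, cell])) hKk

theorem wp_find {R : Fin n → Prop} (hd : ix s .input 0 d = n) (hN : n ≤ N)
    (hb : ∀ (k : Fin n) t, Frame [Arr.found.code, Arr.pos.code, Arr.idle.code] s t →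
      ix t .pos 0 0 = k → (b.Holds t ↔ R k)) :
    wp N G (find d b) (fun t => (ix t .found 0 0 = n ∧ ∀ k, ¬ R k) ∨
      ∃ k : Fin n, ix t .found 0 0 = k ∧ R k) s := by
  have hwrites : writes (.branch b (.setIdx (var .found) (val .pos)) skip) =
    [Arr.found.code, Arr.idle.code] := rfl
  refine wp_seq.2 (wp_setIdx.2 (wp_mono (wp_forLoop (n := n)
    (fun l t => (ix t .found 0 0 = n ∧ ∀ k : Fin n, (k : ℕ) < l → ¬ R k) ∨
      ∃ k : Fin n, ix t .found 0 0 = k ∧ R k)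
    (by simpa using hd) hN (by simp [hd]) (by simp) (fun k hk t ht hKk h => ?_)
    (hwrites ▸ by decide) (hwrites ▸ by decide))
    fun t ht => ht.imp_left fun h => ⟨h.1, fun k => h.2 k k.2⟩))
  have hb := hb ⟨k, hk⟩ t (((Frame.refl [Arr.found.code] s).setIx_right (by simp)).trans
    (hwrites ▸ ht) (by decide) (by decide)) hKk
  refine wp_branch.2 ⟨fun h' => wp_setIdx.2 (.inr ⟨⟨k, hk⟩, by simp [hKk], hb.1 h'⟩),
    fun h' => wp_setIdx.2 (h.imp ?_ ?_)⟩
  · rintro ⟨hn, hR⟩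
    refine ⟨by simpa using hn, fun l hl => ?_⟩
    rcases Nat.lt_succ_iff_lt_or_eq.1 hl with hl | rfl
    · exact hR l hl
    · exact mt hb.2 h'
  · simp

theorem wp_findPair {R : Fin n → Fin m → Prop} (h0 : ix s .input 0 0 = n)
    (hd : ix s .input 0 d = m) (hn : n ≤ N) (hm : m ≤ N)
    (hb : ∀ (k : Fin n) (l : Fin m) t, Frame [Arr.foundRow.code, Arr.foundCol.code, Arr.row.code,
      Arr.col.code, Arr.idle.code] s t → ix t .row 0 0 = k → ix t .col 0 0 = l →
      (b.Holds t ↔ R k l)) :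
    wp N G (findPair d b) (fun t => (ix t .foundRow 0 0 = n ∧ ∀ k l, ¬ R k l) ∨
      ∃ (k : Fin n) (l : Fin m), ix t .foundRow 0 0 = k ∧ ix t .foundCol 0 0 = l ∧ R k l) s := by
  let I : ℕ → ℕ → State → Prop := fun k l t =>
    (ix t .foundRow 0 0 = n ∧ ∀ (k' : Fin n) (l' : Fin m),
      (k' : ℕ) < k ∨ (k' : ℕ) = k ∧ (l' : ℕ) < l → ¬ R k' l') ∨
    ∃ (k : Fin n) (l : Fin m), ix t .foundRow 0 0 = k ∧ ix t .foundCol 0 0 = l ∧ R k l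
  have hinner : writes (.branch b
      (.setIdx (var .foundRow) (val .row) ;; .setIdx (var .foundCol) (val .col)) skip) =
    [Arr.foundRow.code, Arr.foundCol.code, Arr.idle.code] := rfl
  have houter : writes (forLoop .col d (.branch b
      (.setIdx (var .foundRow) (val .row) ;; .setIdx (var .foundCol) (val .col)) skip)) =
    [Arr.col.code, Arr.foundRow.code, Arr.foundCol.code, Arr.idle.code, Arr.col.code] := rfl
  refine wp_seq.2 (wp_setIdx.2 (wp_mono (wp_forLoop (n := n) (I · 0) (by simpa using h0) hn
    (by simp [I, h0]) (by simp [I]) (fun k hk t ht hkt h => ?_) (houter ▸ by decide)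
    (houter ▸ by decide)) fun u hu => hu.imp_left fun h => ⟨h.1, fun k l => h.2 k l (.inl k.2)⟩))
  have ht := ((Frame.refl [Arr.foundRow.code] s).setIx_right (by simp)).trans (houter ▸ ht)
    (V := [Arr.foundRow.code, Arr.foundCol.code, Arr.row.code, Arr.col.code, Arr.idle.code])
    (by decide) (by decide)
  refine wp_mono (wp_forLoop (n := m) (I k) ((ht.ix_eq .input).trans hd) hm h (by simp [I])
    (fun l hl u hu hlu h => ?_) (hinner ▸ by decide) (hinner ▸ by decide))
    fun u hu => hu.imp_left fun h => ⟨h.1, fun k' l' hkl => h.2 k' l' (by lia)⟩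
  rw [hinner] at hu
  have hku := (hu.ix_eq .row).trans hkt
  have hb := hb ⟨k, hk⟩ ⟨l, hl⟩ u (ht.trans hu (by decide) (by decide)) hku hlu
  refine wp_branch.2 ⟨fun h' => wp_seq.2 (wp_setIdx.2 (wp_setIdx.2 (.inr
    ⟨⟨k, hk⟩, ⟨l, hl⟩, by simp [hku], by simp [hlu], hb.1 h'⟩))),
    fun h' => wp_setIdx.2 (h.imp ?_ ?_)⟩
  · rintro ⟨hn, hR⟩
    refine ⟨by simpa using hn, fun k' l' hkl => ?_⟩
    by_cases hkl' : (k' : ℕ) = k ∧ (l' : ℕ) = l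
    · obtain ⟨rfl, rfl⟩ := hkl'
      exact mt hb.2 h'
    · exact hR k' l' (by lia)
  · simp

end Programs

section Phases

/-- The two pricings for which the program balances an allocation: the one before any price is
raised and the one of the current stage. -/
inductive Phase where
  | initial | raised

namespace Phase

/-- The array that holds the allocation to be balanced. -/
def owner : Phase → Arr
  | initial => .home
  | raised => .owner

/-- The array that holds the chores of high price. -/
def high : Phase → Arr
  | initial => .normal
  | raised => .high

/-- The array that holds the agents who only accept easy chores. -/
def closed : Phase → Arr
  | initial => .everyone
  | raised => .closed

/-- The array that holds the low price. -/
def lo : Phase → Arr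
  | initial => .zero
  | raised => .lo

end Phase

/-- The array `A` holds the set `S`. -/
def Flags {k : ℕ} (s : State) (A : Arr) (S : Set (Fin k)) : Prop :=
  ∀ i : Fin k, 0 < ix s A 0 i ↔ i ∈ S

/-- The array `A` holds the function `f`. -/
def Stores {k l : ℕ} (s : State) (A : Arr) (f : Fin k → Fin l) : Prop :=
  ∀ i : Fin k, ix s A 0 i = f i

/-- The memory holds the pricing `κ` in the arrays of `φ`. -/
structure Represents {n m : ℕ} (s : State) (φ : Phase) (κ : Pricing n m) : Prop where
  agents : ix s .input 0 0 = n
  chores : ix s .input 0 1 = m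
  high : Flags s φ.high κ.high
  accepts : ∀ (e : Fin n) (j : Fin m), (0 < ix s φ.closed 0 e → 0 < ix s .easy e j) ↔ κ.accepts e j
  lo : nm s φ.lo 0 0 = κ.lo
  hi : nm s .hi 0 0 = κ.hi

variable {W : List ℕ} {s t : State} {A : Arr} {n m k l : ℕ} {φ : Phase} {κ : Pricing n m}

theorem Frame.flags {S : Set (Fin k)} (h : Frame W s t) (hS : Flags s A S)
    (hA : A.code ∉ W := by decide) : Flags t A S := fun i => by
  rw [h.ix_eq A hA, hS i]

theorem Frame.stores {f : Fin k → Fin l} (h : Frame W s t) (hf : Stores s A f)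
    (hA : A.code ∉ W := by decide) : Stores t A f := fun i => by
  rw [h.ix_eq A hA, hf i]

theorem Represents.frame (h : Represents s φ κ) (hW : Frame W s t)
    (hdisjoint : ∀ A ∈ [.input, .easy, .hi, φ.high, φ.closed, φ.lo], A.code ∉ W := by
      cases φ <;> decide) : Represents t φ κ := by
  simp only [List.forall_mem_cons] at hdisjoint
  obtain ⟨hinput, heasy, hhi, hhigh, hclosed, hlo, -⟩ := hdisjoint
  exact
    { agents := (hW.ix_eq _ hinput).trans h.agents
      chores := (hW.ix_eq _ hinput).trans h.chores
      high := hW.flags h.high hhigh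
      accepts e j := by rw [hW.ix_eq _ hclosed, hW.ix_eq _ heasy, h.accepts]
      lo := (hW.nm_eq _ hlo).trans h.lo
      hi := (hW.nm_eq _ hhi).trans h.hi }

end Phases

section Loads

/-- The program that clears `count` and `load`. -/
def clearLoads : Prog :=
  forLoop .row 0
    (.setIdx (entry .count (val .row)) (.const 0) ;; .setNum (entry .load (val .row)) (.const 0))

/-- The program that adds up the chores of high price of every agent in `count` and the prices of
her chores in `load`. -/
def addLoads (φ : Phase) : Prog :=
  forLoop .col 1
    (.branch (isSet (elem φ.high (val .col)))
      (.setIdx (entry .count (elem φ.owner (val .col)))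
          (.add (elem .count (elem φ.owner (val .col))) (.const 1)) ;;
        .setNum (entry .load (elem φ.owner (val .col)))
          (.add (entry .load (elem φ.owner (val .col))) (var .hi)))
      (.setNum (entry .load (elem φ.owner (val .col)))
        (.add (entry .load (elem φ.owner (val .col))) (var φ.lo))))

/-- The program that computes what remains of the loads without a chore of maximal price. -/
def netLoads (φ : Phase) : Prog :=
  forLoop .row 0
    (.branch (isSet (elem .count (val .row)))
      (.setNum (entry .net (val .row)) (.sub (entry .load (val .row)) (var .hi)))
      (.setNum (entry .net (val .row)) (.sub (entry .load (val .row)) (var φ.lo))))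

/-- The program that computes the loads of an allocation. -/
def loads (φ : Phase) : Prog := clearLoads ;; addLoads φ ;; netLoads φ

/-- All numbers that come up when the prices `lo` and `hi` of at most `m` chores are added or
subtracted have the property `G`. -/
def Covers (G : ℝ → Prop) (m : ℕ) (lo hi : ℝ) : Prop :=
  ∀ u v : ℤ, |u| ≤ m + 1 → |v| ≤ m + 1 → G (u * lo + v * hi)

variable {n m N k : ℕ} {G : ℝ → Prop} {κ : Pricing n m} {φ : Phase} {s t : State}
  {o : Fin m → Fin n}

theorem Covers.zero_left {lo hi : ℝ} (h : Covers G m lo hi) : Covers G m 0 hi := fun u v _ hv => by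
  simpa using h 0 v (by rw [abs_zero]; positivity) hv

theorem Covers.zero {lo hi : ℝ} (h : Covers G m lo hi) : G 0 := by
  simpa using h 0 0 (by rw [abs_zero]; positivity) (by rw [abs_zero]; positivity)

theorem Covers.left {lo hi : ℝ} (h : Covers G m lo hi) : G lo := by
  simpa using h 1 0 (by simp) (by rw [abs_zero]; positivity)

/-- The number and the total price of the chores before the `k`-th one are stored in `count` and
`load`. -/
def Accumulated (κ : Pricing n m) (o : Fin m → Fin n) (k : ℕ) (s : State) : Prop :=
  ∀ i : Fin n, ix s .count 0 i = count o (κ.high ∩ {j | (j : ℕ) < k}) i ∧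
    nm s .load 0 i = κ.hi * count o (κ.high ∩ {j | (j : ℕ) < k}) i +
      κ.lo * count o (κ.highᶜ ∩ {j | (j : ℕ) < k}) i

/-- The arrays `count`, `load` and `net` describe the allocation `o`. -/
structure Loaded (κ : Pricing n m) (o : Fin m → Fin n) (s : State) : Prop where
  count : ∀ i : Fin n, ix s .count 0 i = count o κ.high i
  load : ∀ i : Fin n, nm s .load 0 i = κ.load o i
  net : ∀ i : Fin n, nm s .net 0 i = κ.load o i - κ.top o i

theorem Loaded.frame {W : List ℕ} (h : Loaded κ o s) (hW : Frame W s t)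
    (hdisjoint : ∀ A ∈ [Arr.count, Arr.load, Arr.net], A.code ∉ W := by decide) :
    Loaded κ o t := by
  simp only [List.forall_mem_cons] at hdisjoint
  obtain ⟨hcount, hload, hnet, -⟩ := hdisjoint
  exact
    { count i := (hW.ix_eq _ hcount).trans (h.count i)
      load i := (hW.nm_eq _ hload).trans (h.load i)
      net i := (hW.nm_eq _ hnet).trans (h.net i) }

theorem count_inter_succ (o : Fin m → Fin n) {S : Set (Fin m)} {k : Fin m} {i : Fin n}
    [Decidable (k ∈ S ∧ o k = i)] :
    count o (S ∩ {j | (j : ℕ) < k + 1}) i =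
      count o (S ∩ {j | (j : ℕ) < k}) i + if k ∈ S ∧ o k = i then 1 else 0 := by
  classical
  have hsplit : ∀ j : Fin m, (j : ℕ) < k + 1 ↔ j = k ∨ (j : ℕ) < k := by
    intro j
    rw [Fin.ext_iff]
    lia
  split_ifs with h
  · rw [count, count, ← Finset.card_insert_of_notMem (a := k) (by simp)]
    congr 1
    ext j
    simp only [Set.mem_inter_iff, Set.mem_ofPred_eq, hsplit, Finset.mem_filter, mem_bundles,
      Finset.mem_insert]
    constructor
    · tauto
    · rintro (rfl | h')
      · tauto
      · tauto
  · refine count_congr fun j => ?_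
    simp only [Set.mem_inter_iff, Set.mem_ofPred_eq, hsplit]
    constructor
    · rintro ⟨hj, hjS, rfl | hlt⟩
      · exact absurd ⟨hjS, hj⟩ h
      · exact ⟨hj, hjS, hlt⟩
    · tauto

open Classical in
theorem Accumulated.succ (h : Accumulated κ o k s) (hk : k < m)
    (hcount : ∀ i : Fin n, ix t .count 0 i =
      ix s .count 0 i + if ⟨k, hk⟩ ∈ κ.high ∧ o ⟨k, hk⟩ = i then 1 else 0)
    (hload : ∀ i : Fin n, nm t .load 0 i =
      nm s .load 0 i + if o ⟨k, hk⟩ = i then κ.price ⟨k, hk⟩ else 0) :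
    Accumulated κ o (k + 1) t := by
  intro i
  have hhigh := count_inter_succ o (S := κ.high) (k := ⟨k, hk⟩) (i := i)
  have hlow := count_inter_succ o (S := κ.highᶜ) (k := ⟨k, hk⟩) (i := i)
  simp only at hhigh hlow
  rw [hcount, hload, (h i).1, (h i).2, hhigh, hlow]
  refine ⟨rfl, ?_⟩
  by_cases hi : o ⟨k, hk⟩ = i <;> by_cases hj : ⟨k, hk⟩ ∈ κ.high <;>
    simp [hi, hj, Pricing.price] <;> ring

theorem Accumulated.load_mem (h : Accumulated κ o k s) (hG : Covers G m κ.lo κ.hi) (i : Fin n) :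
    G (nm s .load 0 i) := by
  have hcount : ∀ S : Set (Fin m), |((count o S i : ℕ) : ℤ)| ≤ m + 1 := fun S => by
    rw [Nat.abs_cast]
    exact_mod_cast (count_le o S i).trans m.le_succ
  have := hG _ _ (hcount (κ.highᶜ ∩ {j | (j : ℕ) < k})) (hcount (κ.high ∩ {j | (j : ℕ) < k}))
  rw [(h i).2]
  convert this using 1
  push_cast
  ring

theorem wp_clearLoads (hagents : ix s .input 0 0 = n) (hn : n ≤ N) (hG : G 0) :
    wp N G clearLoads (Accumulated κ o 0) s := by
  refine wp_mono (wp_forLoop (fun k t => ∀ i < k, ix t .count 0 i = 0 ∧ nm t .load 0 i = 0)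
    hagents hn (by simp) (by simp) fun k hk t _ hkt h => ?_) fun t ht i => ?_
  · refine wp_seq.2 (wp_setIdx.2 (wp_zero.2 ⟨hG, fun i hi => ?_⟩))
    rcases Nat.lt_succ_iff_lt_or_eq.1 hi with hi | rfl
    · simpa [hkt, hi.ne] using h i hi
    · simp [hkt]
  · simp [ht i i.2, count]

theorem wp_addLoads (hm : m ≤ N) (hG : Covers G m κ.lo κ.hi) (hκ : Represents s φ κ)
    (ho : Stores s φ.owner o) (h : Accumulated κ o 0 s) :
    wp N G (addLoads φ) (Accumulated κ o m) s := by
  refine wp_forLoop (Accumulated κ o) hκ.chores hm h (fun k t v h i => by simpa using h i)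
    (fun k hk t ht hkt h => ?_) (by cases φ <;> decide) (by cases φ <;> decide)
  classical
  have hκ := hκ.frame ht
  have hok : ix t φ.owner 0 k = o ⟨k, hk⟩ :=
    ht.stores ho (by cases φ <;> decide) ⟨k, hk⟩
  have hcol : (isSet (elem φ.high (val .col))).Holds t ↔ ⟨k, hk⟩ ∈ κ.high := by
    simpa [hkt] using hκ.high ⟨k, hk⟩
  have howner : φ.owner ≠ .count := by cases φ <;> decide
  have hpaid : ∀ {u y}, Accumulated κ o (k + 1) u → nm u .load 0 (o ⟨k, hk⟩) = y →
      G y ∧ Accumulated κ o (k + 1) u := fun hacc hy => ⟨hy ▸ hacc.load_mem hG _, hacc⟩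
  refine wp_branch.2 ⟨fun hb => ?_, fun hb => ?_⟩
  · have hprice := (Pricing.price_of_mem (hcol.1 hb)).trans hκ.hi.symm
    refine wp_seq.2 (wp_setIdx.2 (wp_add.2 (hpaid (h.succ hk (fun i => ?_) fun i => ?_) ?_)))
    · by_cases hi : o ⟨k, hk⟩ = i <;>
        simp [hkt, hok, howner, hcol.1 hb, hi, Fin.val_inj, eq_comm (a := i)]
    · by_cases hi : o ⟨k, hk⟩ = i <;>
        simp [hkt, hok, howner, hprice, hi, Fin.val_inj, eq_comm (a := i)]
    · simp [hkt, hok, howner]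
  · have hprice := (Pricing.price_of_notMem (mt hcol.2 hb)).trans hκ.lo.symm
    refine wp_add.2 (hpaid (h.succ hk (fun i => ?_) fun i => ?_) ?_)
    · simp [mt hcol.2 hb]
    · by_cases hi : o ⟨k, hk⟩ = i <;>
        simp [hkt, hok, hprice, hi, Fin.val_inj, eq_comm (a := i)]
    · simp [hkt, hok]

theorem Accumulated.count_eq (h : Accumulated κ o m s) (i : Fin n) :
    ix s .count 0 i = count o κ.high i := by
  simpa using (h i).1

theorem Accumulated.load_eq (h : Accumulated κ o m s) (i : Fin n) :
    nm s .load 0 i = κ.load o i := by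
  simpa [Pricing.load_eq] using (h i).2

theorem Covers.load_sub_top (hG : Covers G m κ.lo κ.hi) (o : Fin m → Fin n) (i : Fin n) :
    G (κ.load o i - κ.top o i) := by
  have hcount : ∀ S (ε : ℤ), ε = 0 ∨ ε = 1 → |((count o S i : ℕ) : ℤ) - ε| ≤ m + 1 := by
    intro S ε hε
    have := count_le o S i
    rw [abs_le]
    lia
  rw [Pricing.load_eq]
  by_cases hi : 0 < count o κ.high i
  · rw [Pricing.top_of_pos hi]
    convert hG _ _ (hcount κ.highᶜ 0 (.inl rfl)) (hcount κ.high 1 (.inr rfl)) using 1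
    push_cast
    ring
  · rw [Pricing.top_of_not_pos hi]
    convert hG _ _ (hcount κ.highᶜ 1 (.inr rfl)) (hcount κ.high 0 (.inl rfl)) using 1
    push_cast
    ring

theorem wp_netLoads (hn : n ≤ N) (hG : Covers G m κ.lo κ.hi) (hκ : Represents s φ κ)
    (h : Accumulated κ o m s) : wp N G (netLoads φ) (Loaded κ o) s := by
  refine wp_bind (wp_forLoop (fun k t => ∀ i : Fin n, (i : ℕ) < k →
    nm t .net 0 i = κ.load o i - κ.top o i) hκ.agents hn (by simp) (by simp)
    (fun k hk t ht hkt hnet => ?_) (by cases φ <;> decide) (by cases φ <;> decide)) fun t ht hnet =>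
      ⟨fun i => ?_, fun i => ?_, fun i => hnet i i.2⟩
  · have hκ := hκ.frame ht
    have hload : nm t .load 0 k = κ.load o ⟨k, hk⟩ := by
      rw [ht.nm_eq .load (by cases φ <;> decide), h.load_eq ⟨k, hk⟩]
    have hcount : ix t .count 0 k = count o κ.high ⟨k, hk⟩ := by
      rw [ht.ix_eq .count (by cases φ <;> decide), h.count_eq ⟨k, hk⟩]
    have hstep : ∀ y, y = κ.load o ⟨k, hk⟩ - κ.top o ⟨k, hk⟩ → G y ∧ ∀ i : Fin n,
        (i : ℕ) < k + 1 → nm (setNm t .net 0 k y) .net 0 i = κ.load o i - κ.top o i := by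
      rintro y rfl
      refine ⟨hG.load_sub_top o _, fun i hi => ?_⟩
      rcases Nat.lt_succ_iff_lt_or_eq.1 hi with hi | rfl
      · simpa [hi.ne] using hnet i hi
      · simp
    refine wp_branch.2 ⟨fun hb => wp_sub.2 ?_, fun hb => wp_sub.2 ?_⟩
    · have htop := Pricing.top_of_pos (by simpa [hkt, hcount] using hb)
      simpa only [content_cell, index_eval_get, index_eval_const, hkt] using
        hstep (nm t .load 0 k - nm t .hi 0 0) (by rw [hload, hκ.hi, htop])
    · have htop := Pricing.top_of_not_pos (by simpa [hkt, hcount] using hb)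
      simpa only [content_cell, index_eval_get, index_eval_const, hkt] using
        hstep (nm t .load 0 k - nm t φ.lo 0 0) (by rw [hload, hκ.lo, htop])
  · rw [ht.ix_eq .count (by cases φ <;> decide), h.count_eq]
  · rw [ht.nm_eq .load (by cases φ <;> decide), h.load_eq]

theorem wp_loads (hn : n ≤ N) (hm : m ≤ N) (hG : Covers G m κ.lo κ.hi) (hκ : Represents s φ κ)
    (ho : Stores s φ.owner o) : wp N G (loads φ) (Loaded κ o) s := by
  refine wp_seq.2 (wp_bind (wp_clearLoads hκ.agents hn hG.zero) fun t ht h => wp_seq.2 (wp_bind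
    (wp_addLoads hm hG (hκ.frame ht) (ht.stores ho (by cases φ <;> decide)) h) fun u hu h =>
      wp_netLoads hn hG ((hκ.frame ht).frame hu) h))

end Loads

section Transfers

variable {n m : ℕ} {κ : Pricing n m} {o o' o'' : Fin m → Fin n} {i e f : Fin n} {j : Fin m}

theorem count_update_add {S : Set (Fin m)} (hj : j ∈ S) (e f : Fin n) :
    count (Function.update o j e) S f + (if f = o j then 1 else 0) =
      count o S f + if f = e then 1 else 0 := by
  classical
  have hsplit : ∀ o : Fin m → Fin n,
      count o S f = (if f = o j then 1 else 0) + count o (S \ {j}) f := fun o => by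
    rw [count, count, Finset.card_filter, Finset.card_filter, bundles, Finset.sum_filter,
      Finset.sum_filter, ← Finset.add_sum_erase _ _ (Finset.mem_univ j),
      ← Finset.add_sum_erase _ (fun l => if o l = f then _ else _) (Finset.mem_univ j)]
    simp only [hj, eq_comm (a := f), Set.mem_sdiff, Set.mem_singleton_iff, not_true, and_false,
      if_true, if_false, ite_self, zero_add, add_right_inj]
    refine Finset.sum_congr rfl fun l hl => ?_
    simp [Finset.ne_of_mem_erase hl]
  have hrest : count (Function.update o j e) (S \ {j}) f = count o (S \ {j}) f :=
    count_congr fun l => and_congr_left fun hl => by rw [Function.update_of_ne hl.2]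
  rw [hsplit, hsplit o, hrest, Function.update_self]
  lia

/-- The allocation `o'` differs from `o` only in chores of high price, which are owned by agents who
accept them. -/
structure Reassigns (κ : Pricing n m) (o o' : Fin m → Fin n) : Prop where
  fixed : ∀ j ∉ κ.high, o' j = o j
  accepted : ∀ j ∈ κ.high, κ.accepts (o' j) j ∨ o' j = o j

/-- The allocation `o'` is a reassignment of `o` in which `i` owns one chore of high price less and
`e` one more, unless `i = e`. -/
structure Moves (κ : Pricing n m) (o o' : Fin m → Fin n) (i e : Fin n) : Prop
    extends Reassigns κ o o' where
  count_add : ∀ f, count o' κ.high f + (if f = i then 1 else 0) =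
    count o κ.high f + if f = e then 1 else 0

theorem Reassigns.refl (κ : Pricing n m) (o : Fin m → Fin n) : Reassigns κ o o :=
  ⟨fun _ _ => rfl, fun _ _ => .inr rfl⟩

theorem Reassigns.trans (h : Reassigns κ o o') (h' : Reassigns κ o' o'') : Reassigns κ o o'' where
  fixed j hj := (h'.fixed j hj).trans (h.fixed j hj)
  accepted j hj := by
    rcases h'.accepted j hj with h' | h'
    · exact .inl h'
    · rw [h']
      exact h.accepted j hj

theorem Reassigns.count_compl_eq (h : Reassigns κ o o') (f : Fin n) :
    count o' κ.highᶜ f = count o κ.highᶜ f :=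
  count_congr fun j => and_congr_left fun hj => by rw [h.fixed j hj]

theorem Moves.refl (κ : Pricing n m) (o : Fin m → Fin n) (e : Fin n) : Moves κ o o e e :=
  ⟨.refl κ o, fun _ => rfl⟩

theorem Moves.update (h : Moves κ o o' i e) (hj : j ∈ κ.high) (hi : κ.accepts i j) :
    Moves κ o (Function.update o' j i) (o' j) e where
  fixed l hl := by
    rw [Function.update_of_ne (ne_of_mem_of_not_mem hj hl).symm]
    exact h.fixed l hl
  accepted l hl := by
    by_cases hlj : l = j
    · subst hlj
      rw [Function.update_self]
      exact .inl hi
    · rw [Function.update_of_ne hlj]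
      exact h.accepted l hl
  count_add f := (count_update_add hj i f).trans (h.count_add f)

end Transfers

section Potential

variable {n m : ℕ} {b : ℝ} {k k' : Fin n → ℕ} {i e : Fin n}

open Classical in
/-- The number of slots below `z`, where agent `f` has slots at the heights `base f + b * t`. -/
noncomputable def slotsBelow (m : ℕ) (base : Fin n → ℝ) (b z : ℝ) : ℕ :=
  (Finset.univ.filter fun x : Fin n × Fin m => base x.1 + b * (x.2 : ℕ) < z).card

/-- A bound on the number of times that a chore of price `b` can be passed on, when agent `f` owns
`k f` of them and other chores of total price `base f`. The chores of an agent fill her lowest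
slots, and passing on a chore moves it to a slot further down. -/
noncomputable def potential (m : ℕ) (base : Fin n → ℝ) (b : ℝ) (k : Fin n → ℕ) : ℕ :=
  ∑ f, ∑ t ∈ Finset.range (k f), slotsBelow m base b (base f + b * t)

theorem slotsBelow_le (base : Fin n → ℝ) (b z : ℝ) : slotsBelow m base b z ≤ n * m := by
  classical
  exact (Finset.card_le_univ _).trans (by simp)

theorem slotsBelow_lt_slotsBelow {base : Fin n → ℝ} {z z' : ℝ} (hz : z < z') {t : ℕ} (ht : t < m)
    (he : base e + b * t = z) : slotsBelow m base b z < slotsBelow m base b z' := by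
  classical
  refine Finset.card_lt_card <| Finset.ssubset_iff_of_subset
    (Finset.monotone_filter_right _ fun x _ hx => hx.trans hz) |>.2 ⟨(e, ⟨t, ht⟩), ?_, ?_⟩
  · simpa [he] using hz
  · simp [he]

theorem potential_le (base : Fin n → ℝ) (b : ℝ) (hk : ∀ f, k f ≤ m) :
    potential m base b k ≤ n * (m * (n * m)) :=
  calc potential m base b k
    _ ≤ ∑ f, ∑ _t ∈ Finset.range (k f), n * m := by
        rw [potential]
        gcongr
        exact slotsBelow_le _ _ _
    _ = ∑ f, k f * (n * m) := by simp
    _ ≤ ∑ _f : Fin n, m * (n * m) := by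
        gcongr
        exact hk _
    _ = n * (m * (n * m)) := by simp

theorem potential_add_slotsBelow (base : Fin n → ℝ) (b : ℝ) (k : Fin n → ℕ) (i : Fin n) :
    potential m base b k + slotsBelow m base b (base i + b * k i) =
      potential m base b (Function.update k i (k i + 1)) := by
  classical
  rw [potential, potential, ← Finset.add_sum_erase _ _ (Finset.mem_univ i),
    ← Finset.add_sum_erase _ (fun f => ∑ t ∈ Finset.range (Function.update k i (k i + 1) f), _)
      (Finset.mem_univ i), Function.update_self, Finset.sum_range_succ, add_right_comm]
  congr 1
  refine Finset.sum_congr rfl fun f hf => ?_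
  rw [Function.update_of_ne (Finset.ne_of_mem_erase hf)]

theorem potential_lt_potential {base : Fin n → ℝ} (hie : i ≠ e)
    (hk : ∀ f, k' f + (if f = i then 1 else 0) = k f + if f = e then 1 else 0)
    (he : k' e ≤ m) (hlt : base e + b * k e + b < base i + b * k i) :
    potential m base b k' < potential m base b k := by
  have hi : k' i + 1 = k i := by simpa [hie] using hk i
  have he' : k' e = k e + 1 := by simpa [hie.symm] using hk e
  have hupdate : Function.update k' i (k' i + 1) = Function.update k e (k e + 1) := by
    ext f
    have := hk f
    by_cases hfi : f = i <;> by_cases hfe : f = e <;> simp_all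
  have hsum : potential m base b k' + slotsBelow m base b (base i + b * k' i) =
      potential m base b k + slotsBelow m base b (base e + b * k e) := by
    rw [potential_add_slotsBelow, potential_add_slotsBelow, hupdate]
  have hslots : base e + b * k e < base i + b * k' i := by
    rw [← hi] at hlt
    push_cast at hlt
    linarith
  have := slotsBelow_lt_slotsBelow (m := m) hslots (by lia) rfl
  lia

theorem Moves.potential_lt {κ : Pricing n m} {o o' : Fin m → Fin n}
    (h : Moves κ o o' i e) (hlo : 0 ≤ κ.lo) (hhi : 0 ≤ κ.hi) (hr : κ.Reach o i e)
    (hlt : κ.load o e < κ.load o i - κ.top o i) :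
    potential m (fun f => κ.lo * count o' κ.highᶜ f) κ.hi (count o' κ.high) <
      potential m (fun f => κ.lo * count o κ.highᶜ f) κ.hi (count o κ.high) := by
  have hie : i ≠ e := by
    rintro rfl
    have : 0 ≤ κ.top o i := by
      rw [Pricing.top]
      split_ifs
      exacts [hhi, hlo]
    linarith
  have hi : 0 < count o κ.high i := by
    rcases hr.cases_head with h | ⟨x, ⟨j, hj, hji, -⟩, -⟩
    · exact absurd h hie
    · exact count_pos.2 ⟨j, hj, hji⟩
  rw [Pricing.top_of_pos hi, Pricing.load_eq, Pricing.load_eq] at hlt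
  simp only [h.count_compl_eq]
  refine potential_lt_potential hie h.count_add (count_le _ _ _) ?_
  linarith

end Potential

section Reach

variable {n m N : ℕ} {G : ℝ → Prop} {φ : Phase} {κ : Pricing n m} {o : Fin m → Fin n}
  {S : Set (Fin n)} {s t : State} {W : List ℕ} {i e : Fin n} {j : Fin m}

/-- The number of agents with a mark. -/
def marked (n : ℕ) (s : State) : ℕ :=
  (Finset.univ.filter fun i : Fin n => 0 < ix s .mark 0 i).card

/-- The chore `j` can be handed from an agent with a mark to an agent without one. -/
def Extends (κ : Pricing n m) (o : Fin m → Fin n) (s : State) (e : Fin n) (j : Fin m) : Prop :=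
  (j ∈ κ.high ∧ κ.accepts e j) ∧ 0 < ix s .mark 0 (o j) ∧ ¬ 0 < ix s .mark 0 e

/-- The agents with a mark form a forest with roots `S`. The mark of an agent increases with her
depth, and `via` holds the chore through which she is linked to her parent. -/
structure Forest (κ : Pricing n m) (o : Fin m → Fin n) (S : Set (Fin n)) (s : State) : Prop where
  root : ∀ i ∈ S, 0 < ix s .mark 0 i
  edge : ∀ e : Fin n, 0 < ix s .mark 0 e → e ∉ S → ∃ j ∈ κ.high, κ.accepts e j ∧
    ix s .via 0 e = j ∧ 0 < ix s .mark 0 (o j) ∧ ix s .mark 0 (o j) < ix s .mark 0 e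
  mark_le : ∀ e : Fin n, ix s .mark 0 e ≤ m + 1 + marked n s

theorem marked_le (n : ℕ) (s : State) : marked n s ≤ n :=
  (Finset.card_le_univ _).trans (Fintype.card_fin n).le

theorem marked_insert (he : ¬ 0 < ix s .mark 0 e)
    (ht : ∀ i : Fin n, 0 < ix t .mark 0 i ↔ i = e ∨ 0 < ix s .mark 0 i) :
    marked n t = marked n s + 1 := by
  rw [marked, marked, ← Finset.card_insert_of_notMem (a := e) (by simpa using he)]
  congr 1
  ext i
  simp [ht]

theorem Forest.of_flags (hS : Flags s .mark S) (hle : ∀ i : Fin n, ix s .mark 0 i ≤ m + 1) :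
    Forest κ o S s where
  root i hi := (hS i).2 hi
  edge e he heS := absurd ((hS e).1 he) heS
  mark_le e := (hle e).trans (Nat.le_add_right _ _)

theorem Forest.frame (h : Forest κ o S s) (hW : Frame W s t)
    (hmark : Arr.mark.code ∉ W := by decide) (hvia : Arr.via.code ∉ W := by decide) :
    Forest κ o S t := by
  obtain ⟨hroot, hedge, hle⟩ := h
  constructor <;> simpa only [marked, hW.ix_eq .mark hmark, hW.ix_eq .via hvia]

theorem Forest.exists_reach (h : Forest κ o S s) (he : 0 < ix s .mark 0 e) :
    ∃ i ∈ S, κ.Reach o i e := by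
  induction hk : ix s .mark 0 e using Nat.strong_induction_on generalizing e with
  | _ k ih =>
    by_cases heS : e ∈ S
    · exact ⟨e, heS, .refl⟩
    · obtain ⟨j, hj, hej, -, hpos, hlt⟩ := h.edge e he heS
      obtain ⟨i, hi, hr⟩ := ih _ (hk ▸ hlt) hpos rfl
      exact ⟨i, hi, hr.tail ⟨j, hj, rfl, hej⟩⟩

theorem Forest.flags (h : Forest κ o S s) (hno : ∀ e j, ¬ Extends κ o s e j) :
    Flags s .mark {e | ∃ i ∈ S, κ.Reach o i e} := by
  refine fun e => ⟨h.exists_reach, ?_⟩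
  rintro ⟨i, hi, hr⟩
  induction hr with
  | refl => exact h.root i hi
  | tail _ hlink ih =>
    obtain ⟨j, hj, rfl, hej⟩ := hlink
    exact not_not.1 fun he => hno _ j ⟨⟨hj, hej⟩, ih, he⟩

/-- The memory after a mark has been given to `e`, who can receive the chore `j`. -/
def grow (o : Fin m → Fin n) (s : State) (e : Fin n) (j : Fin m) : State :=
  setIx (setIx s .mark 0 e (ix s .mark 0 (o j) + 1)) .via 0 e j

theorem Extends.marked_grow (h : Extends κ o s e j) :
    marked n (grow o s e j) = marked n s + 1 := by
  refine marked_insert h.2.2 fun i => ?_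
  by_cases hi : i = e <;> simp [grow, hi, Fin.val_inj]

theorem Forest.extend (h : Forest κ o S s) (hej : Extends κ o s e j) :
    Forest κ o S (grow o s e j) := by
  obtain ⟨⟨hj, hacc⟩, hpos, he⟩ := id hej
  have hmark : ∀ i : Fin n, ix (grow o s e j) .mark 0 i =
      if i = e then ix s .mark 0 (o j) + 1 else ix s .mark 0 i := fun i => by
    simp [grow, Fin.val_inj]
  have hold : ∀ i : Fin n, 0 < ix s .mark 0 i →
      ix (grow o s e j) .mark 0 i = ix s .mark 0 i := fun i hi => by
    rw [hmark, if_neg]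
    rintro rfl
    exact he hi
  refine ⟨fun i hi => (hold i (h.root i hi)).symm ▸ h.root i hi, fun i hi hiS => ?_, fun i => ?_⟩
  · by_cases hie : i = e
    · subst hie
      refine ⟨j, hj, hacc, by simp [grow], ?_⟩
      rw [hold _ hpos, hmark i, if_pos rfl]
      exact ⟨hpos, Nat.lt_succ_self _⟩
    · rw [hmark, if_neg hie] at hi
      obtain ⟨l, hl, hil, hvia, hpos, hlt⟩ := h.edge i hi hiS
      refine ⟨l, hl, hil, ?_⟩
      rw [hold _ hpos, hold i hi]
      exact ⟨by simpa [grow, Fin.val_inj, hie] using hvia, hpos, hlt⟩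
  · rw [hej.marked_grow, hmark]
    have := h.mark_le i
    have := h.mark_le (o j)
    split_ifs <;> lia

/-- The test whether the chore `col` can be handed from an agent with a mark to agent `row` and she
has none. -/
def extendsTest (φ : Phase) : Test :=
  .conj
    (.conj (isSet (elem φ.high (val .col)))
      (.neg (.conj (isSet (elem φ.closed (val .row)))
        (.neg (isSet (get .easy (val .row) (val .col)))))))
    (.conj (isSet (elem .mark (elem φ.owner (val .col)))) (.neg (isSet (elem .mark (val .row)))))

/-- The program that gives a mark to `foundRow`, who can receive the chore `foundCol`, and searches
for the next such pair. -/
def extendMarks (φ : Phase) : Prog :=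
  .setIdx (entry .mark (val .foundRow))
      (.add (elem .mark (elem φ.owner (val .foundCol))) (.const 1)) ;;
    .setIdx (entry .via (val .foundRow)) (val .foundCol) ;;
    findPair 1 (extendsTest φ)

/-- The program that marks the agents who can be reached from those with a mark. -/
def reach (φ : Phase) : Prog :=
  findPair 1 (extendsTest φ) ;; .loop (ltIdx (val .foundRow) (dim 0)) (extendMarks φ)

theorem holds_extendsTest (hκ : Represents s φ κ) (ho : Stores s φ.owner o)
    (he : ix s .row 0 0 = e) (hj : ix s .col 0 0 = j) :
    (extendsTest φ).Holds s ↔ Extends κ o s e j := by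
  simp only [extendsTest, holds_conj, holds_neg, holds_isSet, index_eval_get, index_eval_const,
    he, hj, ho j, hκ.high j, Extends, ← hκ.accepts, not_and_not_right]

/-- `foundRow` and `foundCol` hold an agent and a chore that extend the marks, if there are any. -/
def Searched (κ : Pricing n m) (o : Fin m → Fin n) (s : State) : Prop :=
  (ix s .foundRow 0 0 = n ∧ ∀ e j, ¬ Extends κ o s e j) ∨
    ∃ e j, ix s .foundRow 0 0 = e.val ∧ ix s .foundCol 0 0 = j.val ∧ Extends κ o s e j

theorem wp_findPair_extendsTest (hn : n ≤ N) (hm : m ≤ N) (hκ : Represents s φ κ)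
    (ho : Stores s φ.owner o) :
    wp N G (findPair 1 (extendsTest φ)) (Searched κ o) s := by
  refine wp_bind (wp_findPair (R := Extends κ o s) hκ.agents hκ.chores hn hm
    fun e j t ht he hj => ?_) fun t ht h => ?_
  · rw [holds_extendsTest (hκ.frame ht) (ht.stores ho (by cases φ <;> decide)) he hj]
    simp only [Extends, ht.ix_eq .mark]
  · have hwrites : Arr.mark.code ∉ writes (findPair 1 (extendsTest φ)) := by cases φ <;> decide
    simpa only [Searched, Extends, ht.ix_eq .mark hwrites] using h

theorem wp_extendMarks (hn : n ≤ N) (hm : m ≤ N) (hκ : Represents s φ κ)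
    (ho : Stores s φ.owner o) (hforest : Forest κ o S s) (hej : Extends κ o s e j)
    (he : ix s .foundRow 0 0 = e) (hj : ix s .foundCol 0 0 = j) :
    wp N G (extendMarks φ)
      (fun t => marked n t = marked n s + 1 ∧ Forest κ o S t ∧ Searched κ o t) s := by
  have hgrow : Frame [Arr.mark.code, Arr.via.code] s (grow o s e j) :=
    (Frame.refl _ s).setIx_right (by simp) |>.setIx_right (by simp)
  refine wp_seq.2 (wp_setIdx.2 (wp_seq.2 (wp_setIdx.2 ?_)))
  simp only [index_eval_add, index_eval_get, index_eval_const, he, hj, ho j, ix_setIx,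
    reduceCtorEq, false_and, if_false]
  refine wp_bind (wp_findPair_extendsTest hn hm (hκ.frame hgrow)
    (hgrow.stores ho (by cases φ <;> decide))) fun t ht hfound => ?_
  have hmark : Arr.mark.code ∉ writes (findPair 1 (extendsTest φ)) := by cases φ <;> decide
  refine ⟨?_, (hforest.extend hej).frame ht hmark (by cases φ <;> decide), hfound⟩
  rw [← hej.marked_grow]
  simp only [marked, ht.ix_eq .mark hmark]
  rfl

theorem wp_reach (hn : n ≤ N) (hm : m ≤ N) (hκ : Represents s φ κ) (ho : Stores s φ.owner o)
    (hS : Flags s .mark S) (hle : ∀ i : Fin n, ix s .mark 0 i ≤ m + 1) :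
    wp N G (reach φ)
      (fun t => Forest κ o S t ∧ Flags t .mark {e | ∃ i ∈ S, κ.Reach o i e}) s := by
  refine wp_seq.2 (wp_bind (wp_findPair_extendsTest hn hm hκ ho) fun t ht hfound => ?_)
  refine wp_loop (fun v u => v = n - marked n u ∧ Forest κ o S u ∧ Searched κ o u) (n - marked n t)
    ((Nat.sub_le _ _).trans hn)
    ⟨rfl, (Forest.of_flags hS hle).frame ht (by cases φ <;> decide) (by cases φ <;> decide),
      hfound⟩ ?_ ?_
  · rintro v u hu ⟨rfl, hforest, hfound⟩ hb
    have hκ := (hκ.frame ht).frame hu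
    have ho := hu.stores (ht.stores ho (by cases φ <;> decide)) (by cases φ <;> decide)
    obtain ⟨e, j, he, hj, hej⟩ := hfound.resolve_left fun h => by
      simp [h.1, hκ.agents] at hb
    refine wp_mono (wp_extendMarks hn hm hκ ho hforest hej he hj) fun w hw => ⟨_, ?_, rfl, hw.2⟩
    have := marked_le n w
    lia
  · rintro v u hu ⟨-, hforest, hfound⟩ hb
    refine ⟨hforest, hforest.flags (hfound.resolve_right ?_).2⟩
    rintro ⟨e, j, he, -⟩
    have hκ := (hκ.frame ht).frame hu
    simp [he, hκ.agents] at hb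

end Reach

section Balance

variable {n m N : ℕ} {G : ℝ → Prop} {φ : Phase} {κ : Pricing n m} {o o' : Fin m → Fin n}
  {S : Set (Fin n)} {s t : State} {i e : Fin n}

/-- The program that hands chores along the path of the forest from agent `target` up to agent
`source`, towards `target`. -/
def handDown (φ : Phase) : Prog :=
  .loop (.neg (.conj (.leIdx (val .target) (val .source)) (.leIdx (val .source) (val .target))))
    (.setIdx (var .parent) (elem φ.owner (elem .via (val .target))) ;;
      .setIdx (entry φ.owner (elem .via (val .target))) (val .target) ;;
      .setIdx (var .target) (val .parent))

/-- The test whether the agent `pos` has a mark and is envied by `source`. -/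
def enviedTest : Test :=
  .conj (isSet (elem .mark (val .pos)))
    (ltNum (entry .load (val .pos)) (entry .net (val .source)))

/-- The program that marks the agents whom `source` can reach and searches for one whom she envies
among them. -/
def explore (φ : Phase) : Prog :=
  loads φ ;;
  fill .mark 0 (.const 0) ;;
  .setIdx (entry .mark (val .source)) (.const 1) ;;
  reach φ ;;
  find 0 enviedTest

/-- The program that either removes the envy of `source` towards one of the agents whom she can
reach and starts again from the first agent, or continues with the next agent. -/
def balanceSource (φ : Phase) : Prog :=
  explore φ ;;
  .branch (ltIdx (val .found) (dim 0))
    (.setIdx (var .target) (val .found) ;; handDown φ ;; .setIdx (var .source) (.const 0))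
    (.setIdx (var .source) (.add (val .source) (.const 1)))

/-- The program that balances an allocation. -/
def balance (φ : Phase) : Prog :=
  .setIdx (var .source) (.const 0) ;; .loop (ltIdx (val .source) (dim 0)) (balanceSource φ)

/-- A bound on the number of rounds of every loop. -/
def rounds (n m : ℕ) : ℕ := (n + m + 2) ^ 5

theorem add_le_rounds (n m : ℕ) : n + m + 2 ≤ rounds n m :=
  Nat.le_self_pow (by simp) _

theorem potential_mul_add_le_rounds (base : Fin n → ℝ) (b : ℝ) {k : Fin n → ℕ}
    (hk : ∀ f, k f ≤ m) : potential m base b k * (n + 1) + n ≤ rounds n m :=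
  calc potential m base b k * (n + 1) + n
    _ ≤ n * (m * (n * m)) * (n + 1) + n := by
        gcongr
        exact potential_le base b hk
    _ ≤ rounds n m := by
        rw [rounds]
        ring_nf
        lia

theorem wp_handDown (hN : n + m + 1 ≤ N) (ho : Stores s φ.owner o) (hi : ix s .source 0 0 = i)
    (hforest : Forest κ o {i} s) (he : ix s .target 0 0 = e) (hpos : 0 < ix s .mark 0 e) :
    wp N G (handDown φ) (fun t => ∃ o', Stores t φ.owner o' ∧ Moves κ o o' i e) s := by
  refine wp_loop (fun v t => ∃ (f : Fin n) (o' : Fin m → Fin n), v = ix s .mark 0 f ∧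
    ix t .target 0 0 = f ∧ 0 < ix s .mark 0 f ∧ Stores t φ.owner o' ∧ Moves κ o o' f e ∧
    ∀ j, ix s .mark 0 (o j) < ix s .mark 0 f → o' j = o j) (ix s .mark 0 e) ?_
    ⟨e, o, rfl, he, hpos, ho, .refl κ o e, fun _ _ => rfl⟩ ?_ ?_
  · have := hforest.mark_le e
    have := marked_le n s
    lia
  · rintro v t ht ⟨f, o', rfl, hf, hpos, ho, hmoves, hold⟩ hb
    have hfi : f ∉ ({i} : Set (Fin n)) := by
      rintro rfl
      have := ht.ix_eq (i := 0) (j := 0) .source (by cases φ <;> decide)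
      simp [Test.Holds, hf, this, hi] at hb
    obtain ⟨j, hj, hacc, hvia, hpar, hlt⟩ := hforest.edge f hpos hfi
    have hvia : ix t .via 0 f = j := (ht.ix_eq .via (by cases φ <;> decide)).trans hvia
    refine wp_seq.2 (wp_setIdx.2 (wp_seq.2 (wp_setIdx.2 (wp_setIdx.2
      ⟨_, hlt, o j, Function.update o' j f, rfl, ?_, hpar, fun l => ?_,
        hold j hlt ▸ hmoves.update hj hacc, fun l hl => ?_⟩))))
    · have howner : φ.owner ≠ .parent := by cases φ <;> decide
      simp [hf, hvia, ho j, hold j hlt, howner.symm]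
    · have howner : φ.owner ≠ .parent ∧ φ.owner ≠ .target := by cases φ <;> decide
      by_cases hlj : l = j <;> simp [hf, hvia, ho l, hlj, howner, Fin.val_inj]
    · rw [Function.update_of_ne (by rintro rfl; exact hl.ne rfl), hold l (hl.trans hlt)]
  · rintro v t ht ⟨f, o', rfl, hf, -, ho, hmoves, -⟩ hb
    have hsource := ht.ix_eq (i := 0) (j := 0) .source (by cases φ <;> decide)
    have hfi : f = i := by
      rw [holds_neg, not_not, holds_conj] at hb
      simp only [Test.Holds, index_eval_get, index_eval_const, hf, hsource, hi] at hb
      exact Fin.ext (hb.1.antisymm hb.2)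
    exact ⟨o', ho, hfi ▸ hmoves⟩

theorem wp_find_enviedTest (hn : n ≤ N) (hagents : ix s .input 0 0 = n) (h : Loaded κ o s)
    (hS : Flags s .mark S) (hi : ix s .source 0 0 = i) :
    wp N G (find 0 enviedTest)
      (fun t => (ix t .found 0 0 = n ∧ ∀ e, ¬ (e ∈ S ∧ κ.load o e < κ.load o i - κ.top o i)) ∨
        ∃ e : Fin n, ix t .found 0 0 = e ∧ e ∈ S ∧ κ.load o e < κ.load o i - κ.top o i) s :=
  wp_find hagents hn fun e t ht he => by
    have h := h.frame ht
    have hi := (ht.ix_eq .source).trans hi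
    have hS := ht.flags hS
    simp only [enviedTest, holds_conj, holds_isSet, holds_ltNum, content_cell, index_eval_get,
      index_eval_const, he, hi, h.load, h.net, hS e]

theorem wp_explore (hn : n ≤ N) (hm : m ≤ N) (hG : Covers G m κ.lo κ.hi) (hκ : Represents s φ κ)
    (ho : Stores s φ.owner o) (hi : ix s .source 0 0 = i) :
    wp N G (explore φ) (fun t => Forest κ o {i} t ∧
      ((ix t .found 0 0 = n ∧ ∀ e, κ.Reach o i e → ¬ κ.load o e < κ.load o i - κ.top o i) ∨
        ∃ e : Fin n, ix t .found 0 0 = e ∧ 0 < ix t .mark 0 e ∧ κ.Reach o i e ∧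
          κ.load o e < κ.load o i - κ.top o i)) s := by
  refine wp_seq.2 (wp_bind (wp_loads hn hm hG hκ ho) fun t ht hloaded => ?_)
  have hκ := hκ.frame ht
  have ho := ht.stores ho (by cases φ <;> decide)
  have hi := (ht.ix_eq .source (by cases φ <;> decide)).trans hi
  refine wp_seq.2 (wp_bind (wp_fill (f := fun _ => 0) hκ.agents hn fun _ _ _ _ => rfl)
    fun u hu hzero => wp_seq.2 (wp_setIdx.2 ?_))
  have hframe : Frame [Arr.mark.code, Arr.pos.code] t (setIx u .mark 0 i 1) :=
    hu.trans ((Frame.refl [Arr.mark.code] u).setIx_right (by simp)) (by decide) (by decide)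
  have hmark : ∀ e : Fin n, ix (setIx u .mark 0 i 1) .mark 0 e = if e = i then 1 else 0 :=
    fun e => by simp [hzero, Fin.val_inj]
  simp only [index_eval_get, index_eval_const, (hu.ix_eq .source).trans hi]
  refine wp_seq.2 (wp_bind (wp_reach (S := {i}) hn hm (hκ.frame hframe)
    (hframe.stores ho (by cases φ <;> decide)) (fun e => ?_) fun e => ?_)
    fun w hw ⟨hforest, hflags⟩ => ?_)
  · rw [hmark]
    split_ifs <;> simp_all
  · rw [hmark]
    split_ifs <;> lia
  have hw := hframe.trans hw (V := writes (fill .mark 0 (.const 0) ;; reach φ))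
    (by cases φ <;> decide) (by cases φ <;> decide)
  have hflags : Flags w .mark {e | κ.Reach o i e} := by simpa using hflags
  refine wp_bind (wp_find_enviedTest hn (hκ.frame hw).agents
    (hloaded.frame hw (by cases φ <;> decide)) hflags
    ((hw.ix_eq .source (by cases φ <;> decide)).trans hi)) fun x hx hfound =>
      ⟨hforest.frame hx, hfound.imp ?_ ?_⟩
  · rintro ⟨hfound, hno⟩
    exact ⟨hfound, fun e hr hlt => hno e ⟨hr, hlt⟩⟩
  · rintro ⟨e, he, hr, hlt⟩
    have hmark := hx.flags hflags
    exact ⟨e, he, (hmark e).2 hr, hr, hlt⟩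

theorem wp_balanceSource (hN : n + m + 1 ≤ N) (hG : Covers G m κ.lo κ.hi)
    (hκ : Represents s φ κ) (ho : Stores s φ.owner o) (hi : ix s .source 0 0 = i) :
    wp N G (balanceSource φ) (fun t =>
      (ix t .source 0 0 = i + 1 ∧ Stores t φ.owner o ∧
        ∀ e, κ.Reach o i e → ¬ κ.load o e < κ.load o i - κ.top o i) ∨
      ∃ o' e, ix t .source 0 0 = 0 ∧ Stores t φ.owner o' ∧ Moves κ o o' i e ∧ κ.Reach o i e ∧
        κ.load o e < κ.load o i - κ.top o i) s := by
  refine wp_seq.2 (wp_bind (wp_explore (by lia) (by lia) hG hκ ho hi)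
    fun t ht ⟨hforest, hfound⟩ => ?_)
  have hκ := hκ.frame ht
  have ho := ht.stores ho (by cases φ <;> decide)
  have hi := (ht.ix_eq .source (by cases φ <;> decide)).trans hi
  refine wp_branch.2 ⟨fun hb => ?_, fun hb => ?_⟩
  · obtain ⟨e, he, hpos, hr, hlt⟩ := hfound.resolve_left fun h => by
      simp [h.1, hκ.agents] at hb
    have hframe : Frame [Arr.target.code] t (setIx t .target 0 0 e) :=
      (Frame.refl _ t).setIx_right (by simp)
    refine wp_seq.2 (wp_setIdx.2 ?_)
    simp only [index_eval_get, index_eval_const, he]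
    refine wp_seq.2 (wp_mono (wp_handDown (i := i) (e := e) hN
      (hframe.stores ho (by cases φ <;> decide)) (by simpa using hi) (hforest.frame hframe)
      (by simp) (by simpa using hpos)) ?_)
    rintro u ⟨o', ho', hmoves⟩
    have hsource : Frame [Arr.source.code] u (setIx u .source 0 0 0) :=
      (Frame.refl _ u).setIx_right (by simp)
    exact wp_setIdx.2 (.inr ⟨o', e, by simp, hsource.stores ho' (by cases φ <;> decide), hmoves,
      hr, hlt⟩)
  · have hno := hfound.resolve_right fun ⟨e, he, _⟩ => by
      simp [he, hκ.agents] at hb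
    have hsource : Frame [Arr.source.code] t (setIx t .source 0 0 (i + 1)) :=
      (Frame.refl _ t).setIx_right (by simp)
    simp only [wp_setIdx, index_eval_get, index_eval_const, index_eval_add, hi]
    exact .inl ⟨by simp, hsource.stores ho (by cases φ <;> decide), hno.2⟩

theorem wp_balance (hG : Covers G m κ.lo κ.hi) (hκ : Represents s φ κ) (ho : Stores s φ.owner o)
    (hlo : 0 ≤ κ.lo) (hhi : 0 ≤ κ.hi) :
    wp (rounds n m) G (balance φ)
      (fun t => ∃ o', Stores t φ.owner o' ∧ Reassigns κ o o' ∧ κ.Balanced o') s := by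
  let pot : (Fin m → Fin n) → ℕ :=
    fun o => potential m (fun f => κ.lo * count o κ.highᶜ f) κ.hi (count o κ.high)
  have hsource : Frame [Arr.source.code] s (setIx s .source 0 0 0) :=
    (Frame.refl _ s).setIx_right (by simp)
  refine wp_seq.2 (wp_setIdx.2 (wp_loop (fun v t => ∃ o' k, k ≤ n ∧
    v = pot o' * (n + 1) + (n - k) ∧ ix t .source 0 0 = k ∧ Stores t φ.owner o' ∧
    Reassigns κ o o' ∧ ∀ i : Fin n, (i : ℕ) < k → ∀ e, κ.Reach o' i e →
      ¬ κ.load o' e < κ.load o' i - κ.top o' i) (pot o * (n + 1) + n) ?_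
    ⟨o, 0, n.zero_le, rfl, by simp, hsource.stores ho (by cases φ <;> decide), .refl κ o,
      by simp⟩ ?_ ?_))
  · exact potential_mul_add_le_rounds _ _ (count_le o _)
  · rintro v t ht ⟨o', k, hk, rfl, hkt, ho', hre, hno⟩ hb
    have hκ := (hκ.frame hsource).frame ht
    have hk : k < n := by simpa [hkt, hκ.agents] using hb
    refine wp_mono (wp_balanceSource (i := ⟨k, hk⟩) ((add_le_rounds n m).trans' (by lia)) hG hκ ho'
      hkt) ?_
    rintro u (⟨hku, ho', hno'⟩ | ⟨o'', e, hu, ho'', hmoves, hr, hlt⟩)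
    · refine ⟨_, ?_, o', k + 1, hk, rfl, hku, ho', hre, fun i hi => ?_⟩
      · lia
      · rcases Nat.lt_succ_iff_lt_or_eq.1 hi with hi | hi
        · exact hno i hi
        · exact (Fin.ext hi : i = ⟨k, hk⟩) ▸ hno'
    · have hpot : pot o'' < pot o' := hmoves.potential_lt hlo hhi hr hlt
      refine ⟨_, ?_, o'', 0, n.zero_le, rfl, hu, ho'', hre.trans hmoves.toReassigns, by simp⟩
      have := Nat.mul_le_mul_right (n + 1) hpot
      lia
  · rintro v t ht ⟨o', k, -, rfl, hkt, ho', hre, hno⟩ hb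
    have hκ := (hκ.frame hsource).frame ht
    have hk : n ≤ k := by simpa [hkt, hκ.agents] using hb
    refine ⟨o', ho', hre, fun i e hr => ?_⟩
    have := hno i (i.2.trans_le hk) e hr
    linarith

end Balance

section Stages

variable {n m N τ : ℕ} {G : ℝ → Prop} {M : Market n m} {C : Set (Fin n)} {o : Fin m → Fin n}
  {W : List ℕ} {s t : State} {z : Fin n}

open Classical in
/-- The allocation at the beginning of a stage, in which the agent `z` has all hard chores. -/
noncomputable def Market.start (M : Market n m) (z : Fin n) (j : Fin m) : Fin n :=
  if j ∈ M.hard then z else M.home j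

theorem Market.Valid.isStage (hM : M.Valid) (hz : z ∉ C) (h : Reassigns (M.raised C) (M.start z) o)
    (ho : (M.raised C).Balanced o) : M.IsStage C o where
  fixed j hj := (h.fixed j hj).trans (if_neg fun hh => hj (.inl hh))
  accepted j hj := by
    rcases h.accepted j hj with hacc | hstart
    · exact hacc
    · by_cases hhard : j ∈ M.hard
      · exact .inl (by rwa [hstart, Market.start, if_pos hhard])
      · exact .inr (by
          rw [hstart, Market.start, if_neg hhard]
          exact hM.easy_home j hhard)
  balanced := ho

/-- The memory holds the market `M` in such a way that it represents the initial pricing. -/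
structure Prepared (M : Market n m) (s : State) : Prop where
  agents : ix s .input 0 0 = n
  chores : ix s .input 0 1 = m
  easy : ∀ (i : Fin n) (j : Fin m), 0 < ix s .easy i j ↔ M.easy i j
  home : Stores s .home M.home
  hard : Flags s .hard M.hard
  normal : Flags s .normal M.hardᶜ
  everyone : Flags s .everyone (Set.univ : Set (Fin n))
  zero : nm s .zero 0 0 = 0
  lo : nm s .lo 0 0 = M.lo
  hi : nm s .hi 0 0 = M.hi

theorem Prepared.rehome (h : Prepared M s) (hW : Frame W s t) (ho : Stores t .home o)
    (hdisjoint : ∀ A ∈ [Arr.input, .easy, .hard, .normal, .everyone, .zero, .lo, .hi],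
      A.code ∉ W := by decide) : Prepared { M with home := o } t := by
  simp only [List.forall_mem_cons] at hdisjoint
  obtain ⟨hinput, heasy, hhard, hnormal, heveryone, hzero, hlo, hhi, -⟩ := hdisjoint
  exact
    { agents := (hW.ix_eq _ hinput).trans h.agents
      chores := (hW.ix_eq _ hinput).trans h.chores
      easy i j := by rw [hW.ix_eq _ heasy, h.easy]
      home := ho
      hard := hW.flags h.hard hhard
      normal := hW.flags h.normal hnormal
      everyone := hW.flags h.everyone heveryone
      zero := (hW.nm_eq _ hzero).trans h.zero
      lo := (hW.nm_eq _ hlo).trans h.lo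
      hi := (hW.nm_eq _ hhi).trans h.hi }

theorem Prepared.frame (h : Prepared M s) (hW : Frame W s t)
    (hdisjoint : ∀ A ∈ [Arr.home, .input, .easy, .hard, .normal, .everyone, .zero, .lo, .hi],
      A.code ∉ W := by decide) : Prepared M t :=
  have hdisjoint := List.forall_mem_cons.1 hdisjoint
  h.rehome hW (hW.stores h.home hdisjoint.1) hdisjoint.2

theorem Prepared.represents_initial (h : Prepared M s) : Represents s .initial M.initial where
  agents := h.agents
  chores := h.chores
  high := h.normal
  accepts e j := by
    rw [Phase.closed, h.easy]
    exact imp_iff_right ((h.everyone e).2 trivial)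
  lo := h.zero
  hi := h.hi

/-- The program that marks the agents of the layer `cut`. -/
def markLayer : Prog :=
  loads .initial ;;
  fill .mark 0 (.sub (.add (elem .count (val .pos)) (.const 1)) (val .cut)) ;;
  reach .initial

/-- The program that raises the prices of the chores of the agents with a mark. -/
def raisePrices : Prog :=
  fill .high 1 (.add (elem .hard (val .pos)) (elem .mark (elem .home (val .pos)))) ;;
  fill .closed 0 (elem .mark (val .pos))

/-- The program that gives the hard chores to an agent without a mark. -/
def assignHard : Prog :=
  find 0 (.neg (isSet (elem .mark (val .pos)))) ;;
  forLoop .col 1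
    (.branch (isSet (elem .hard (val .col)))
      (.setIdx (entry .owner (val .col)) (val .found))
      (.setIdx (entry .owner (val .col)) (elem .home (val .col))))

/-- The program that searches for an agent `foundRow` who envies another one up to one chore. -/
def findEnvy : Prog :=
  loads .raised ;; findPair 0 (ltNum (entry .load (val .col)) (entry .net (val .row)))

/-- The program for the stage with the threshold `cut`. -/
def stage : Prog := markLayer ;; raisePrices ;; assignHard ;; balance .raised ;; findEnvy

/-- The program that lowers the threshold until there is no more envy. -/
def stages : Prog :=
  .setIdx (var .cut) (.add (dim 1) (.const 1)) ;;
  stage ;;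
  .loop (ltIdx (val .foundRow) (dim 0)) (.setIdx (var .cut) (.sub (val .cut) (.const 1)) ;; stage)

theorem wp_markLayer (hn : n ≤ N) (hm : m ≤ N) (hG : Covers G m 0 M.hi) (hM : Prepared M s)
    (hτ : ix s .cut 0 0 = τ) : wp N G markLayer (fun t => Flags t .mark (M.layer τ)) s := by
  refine wp_seq.2 (wp_bind (wp_loads hn hm hG hM.represents_initial hM.home) fun t ht hloaded => ?_)
  have hM := hM.frame ht
  have hτ := (ht.ix_eq .cut).trans hτ
  refine wp_seq.2 (wp_bind (wp_fill (f := fun i => M.homeCount i + 1 - τ) hM.agents hn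
    fun i u hu hi => ?_) fun u hu hmark => ?_)
  · simp [hi, hu.ix_eq .count, hloaded.count i, hu.ix_eq .cut, hτ, Market.homeCount, Market.initial]
  · have hM := hM.frame hu
    refine wp_mono (wp_reach (S := {i | τ ≤ M.homeCount i}) hn hm hM.represents_initial hM.home
      (fun i => ?_) fun i => ?_) fun v hv => hv.2
    · rw [hmark, Set.mem_ofPred_eq]
      lia
    · have := count_le M.home M.hardᶜ i
      rw [hmark, Market.homeCount]
      lia

theorem wp_raisePrices (hn : n ≤ N) (hm : m ≤ N) (hM : Prepared M s) (hC : Flags s .mark C) :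
    wp N G raisePrices (fun t => Represents t .raised (M.raised C)) s := by
  refine wp_seq.2 (wp_bind (wp_fill (f := fun j => ix s .hard 0 j + ix s .mark 0 (M.home j))
    hM.chores hm fun j t ht hj => ?_) fun t ht hhigh => ?_)
  · simp [hj, ht.ix_eq .hard, ht.ix_eq .mark, ht.ix_eq .home, hM.home j]
  have hM := hM.frame ht
  refine wp_bind (wp_fill (f := fun i => ix s .mark 0 i) hM.agents hn fun i u hu hi => ?_)
    fun u hu hclosed => ?_
  · simp [hi, hu.ix_eq .mark, ht.ix_eq .mark]
  have hM := hM.frame hu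
  exact
    { agents := hM.agents
      chores := hM.chores
      high j := by
        rw [Phase.high, hu.ix_eq .high, hhigh, Nat.add_pos_iff_pos_or_pos, hC,
          ← ht.ix_eq .hard, ← hu.ix_eq .hard, hM.hard]
        rfl
      accepts e j := by
        rw [Phase.closed, hclosed, hC, hM.easy, imp_iff_not_or]
        rfl
      lo := hM.lo
      hi := hM.hi }

theorem wp_assignHard (hn : n ≤ N) (hm : m ≤ N) (hM : Prepared M s) (hC : Flags s .mark C)
    (hz : ∃ z, z ∉ C) : wp N G assignHard (fun t => ∃ z ∉ C, Stores t .owner (M.start z)) s := by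
  refine wp_seq.2 (wp_bind (wp_find (R := (· ∉ C)) hM.agents hn fun i t ht hi => ?_)
    fun t ht hfound => ?_)
  · simp [hi, ht.ix_eq .mark, ← hC i]
  obtain ⟨z, hfz, hzC⟩ := hfound.resolve_left fun h => hz.elim h.2
  have hM := hM.frame ht
  refine wp_mono (wp_forLoop (fun k t => ∀ j : Fin m, (j : ℕ) < k →
    ix t .owner 0 j = M.start z j) hM.chores hm (by simp) (by simp) fun k hk u hu hku h => ?_)
    fun u h => ⟨z, hzC, fun j => h j j.2⟩
  have hM := hM.frame hu
  have hstep : ∀ l, l = (M.start z ⟨k, hk⟩ : ℕ) → ∀ j : Fin m, (j : ℕ) < k + 1 →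
      ix (setIx u .owner 0 k l) .owner 0 j = M.start z j := by
    rintro l rfl j hj
    rcases Nat.lt_succ_iff_lt_or_eq.1 hj with hj | rfl
    · simpa [hj.ne] using h j hj
    · simp
  have hhard := hM.hard ⟨k, hk⟩
  refine wp_branch.2 ⟨fun hb => wp_setIdx.2 ?_, fun hb => wp_setIdx.2 ?_⟩
  · have hmem : ⟨k, hk⟩ ∈ M.hard := by simpa [← hhard, hku] using hb
    simpa only [index_eval_get, index_eval_const, hku] using
      hstep _ (by rw [hu.ix_eq .found, hfz, Market.start, if_pos hmem])
  · have hmem : ⟨k, hk⟩ ∉ M.hard := by simpa [← hhard, hku] using hb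
    simpa only [index_eval_get, index_eval_const, hku] using
      hstep _ (by rw [hM.home ⟨k, hk⟩, Market.start, if_neg hmem])

theorem wp_findEnvy {κ : Pricing n m} (hn : n ≤ N) (hm : m ≤ N) (hG : Covers G m κ.lo κ.hi)
    (hκ : Represents s .raised κ) (ho : Stores s .owner o) :
    wp N G findEnvy (fun t =>
      (ix t .foundRow 0 0 = n ∧ ∀ i e, κ.load o i ≤ κ.load o e + κ.top o i) ∨
        ∃ i : Fin n, ix t .foundRow 0 0 = i ∧ ∃ e, κ.load o e + κ.top o i < κ.load o i) s := by
  refine wp_seq.2 (wp_bind (wp_loads hn hm hG hκ ho) fun t ht hloaded => ?_)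
  have hκ := hκ.frame ht (by decide)
  refine wp_mono (wp_findPair (R := fun i e => κ.load o e + κ.top o i < κ.load o i) hκ.agents
    hκ.agents hn hn fun i e u hu hi he => ?_) fun u hu => hu.imp ?_ ?_
  · have hloaded := hloaded.frame hu
    simp [hi, he, hloaded.load, hloaded.net, lt_sub_iff_add_lt]
  · rintro ⟨hrow, hno⟩
    exact ⟨hrow, fun i e => not_lt.1 (hno i e)⟩
  · rintro ⟨i, e, hi, -, hlt⟩
    exact ⟨i, hi, e, hlt⟩

/-- The memory after the stage with the threshold `τ`, which resulted in the allocation `o`. -/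
structure Staged (M : Market n m) (τ : ℕ) (o : Fin m → Fin n) (s : State) : Prop where
  prepared : Prepared M s
  cut : ix s .cut 0 0 = τ
  owner : Stores s .owner o
  isStage : M.IsStage (M.layer τ) o
  envy : (ix s .foundRow 0 0 = n ∧ ∀ i e, (M.raised (M.layer τ)).load o i ≤
      (M.raised (M.layer τ)).load o e + (M.raised (M.layer τ)).top o i) ∨
    ∃ i : Fin n, ix s .foundRow 0 0 = i ∧ ∃ e, (M.raised (M.layer τ)).load o e +
      (M.raised (M.layer τ)).top o i < (M.raised (M.layer τ)).load o i

variable (hM : M.Valid) (hG : Covers G m M.lo M.hi)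

include hM hG

theorem wp_stage (hs : Prepared M s) (hτ : ix s .cut 0 0 = τ) (hz : ∃ z, z ∉ M.layer τ) :
    wp (rounds n m) G stage (fun t => ∃ o, Staged M τ o t) s := by
  have hN := add_le_rounds n m
  have hn : n ≤ rounds n m := by lia
  have hm : m ≤ rounds n m := by lia
  refine wp_bind (Q' := fun t => ∃ o, Stores t .owner o ∧ M.IsStage (M.layer τ) o ∧ _) ?_
    fun t ht ⟨o, ho, hstage, henvy⟩ => ⟨o, hs.frame ht, (ht.ix_eq .cut).trans hτ, ho, hstage, henvy⟩
  refine wp_seq.2 (wp_bind (wp_markLayer hn hm hG.zero_left hs hτ) fun t₁ ht₁ hmark => ?_)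
  have hs := hs.frame ht₁
  refine wp_seq.2 (wp_bind (wp_raisePrices hn hm hs hmark) fun t₂ ht₂ hκ => ?_)
  refine wp_seq.2 (wp_bind (wp_assignHard hn hm (hs.frame ht₂) (ht₂.flags hmark) hz)
    fun t₃ ht₃ ⟨z, hz, hstart⟩ => ?_)
  have hκ := hκ.frame ht₃ (by decide)
  refine wp_seq.2 (wp_bind (wp_balance hG hκ hstart hM.lo_pos.le hM.hi_pos.le)
    fun t₄ ht₄ ⟨o, ho, hre, hbal⟩ => ?_)
  have hκ := hκ.frame ht₄ (by decide)
  refine wp_bind (wp_findEnvy hn hm hG hκ ho) fun t₅ ht₅ henvy => ?_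
  exact ⟨o, ht₅.stores ho, hM.isStage hz hre hbal, henvy⟩

theorem wp_stages (hs : Prepared M s) (hn : 0 < n) :
    wp (rounds n m) G stages (fun t => ∃ o τ, Stores t .owner o ∧ M.IsStage (M.layer τ) o ∧
      ∀ i e, (M.raised (M.layer τ)).load o i ≤
        (M.raised (M.layer τ)).load o e + (M.raised (M.layer τ)).top o i) s := by
  have hempty : ∀ i, i ∉ M.layer (m + 1) := fun i ⟨e, he, _⟩ => (count_le _ _ _).not_gt he
  have hcut : ∀ {t k}, Frame [Arr.cut.code] t (setIx t .cut 0 0 k) := fun {t k} =>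
    (Frame.refl _ t).setIx_right (by simp)
  refine wp_seq.2 (wp_setIdx.2 (wp_seq.2 (wp_mono (wp_stage hM hG (τ := m + 1)
    (hs.frame hcut) (by simp [hs.chores]) ⟨⟨0, hn⟩, hempty _⟩) fun t ⟨o, h⟩ => ?_)))
  refine wp_loop (fun v t => ∃ o, Staged M (v + 1) o t ∧ M.Settled (M.layer (v + 1)) o) m
    ((add_le_rounds n m).trans' (by lia)) ⟨o, h, h.isStage.settled_of_empty hempty⟩ ?_ ?_
  · rintro v t - ⟨o, h, hsettled⟩ hb
    obtain ⟨i, -, e, hlt⟩ := h.envy.resolve_left fun henvy => by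
      simp [henvy.1, h.prepared.agents] at hb
    have hlayer := hM.isLayer_layer (v + 1)
    have E : M.IsEnvious v (M.layer (v + 1)) o :=
      ⟨hlayer, h.isStage, hsettled, e, h.isStage.load_add_lo_lt_of_envy hM hlayer hsettled hlt⟩
    obtain ⟨z, hz⟩ := E.exists_homeCount_add_one_lt hM
    obtain ⟨w, rfl⟩ := Nat.exists_eq_succ_of_ne_zero (by have := E.two_le hM; lia : v ≠ 0)
    have hlayer := hM.isLayer_layer (w + 1)
    refine wp_seq.2 (wp_setIdx.2 (wp_mono (wp_stage hM hG (τ := w + 1)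
      (h.prepared.frame hcut) (by simp [h.cut]) ⟨z, hlayer.notMem hz⟩) ?_))
    exact fun u ⟨o', h'⟩ => ⟨w, w.lt_succ_self, o', h', E.settled_next hlayer hM h'.isStage⟩
  · rintro v t - ⟨o, h, -⟩ hb
    refine ⟨o, v + 1, h.owner, h.isStage, (h.envy.resolve_right ?_).2⟩
    rintro ⟨i, hi, -⟩
    simp [hi, h.prepared.agents] at hb

end Stages

section Bits

variable {n m B k l : ℕ} {q q₀ q₁ : ℚ} {u v : ℤ}

theorem abs_eq_natAbs_num_div_den (q : ℚ) : |q| = q.num.natAbs / q.den := by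
  conv_lhs => rw [← Rat.num_div_den q]
  rw [abs_div, Nat.abs_cast, Nat.cast_natAbs, Int.cast_abs]

theorem natAbs_num_le_two_pow (h : ratBits q ≤ B) : q.num.natAbs ≤ 2 ^ B :=
  (Nat.size_le.1 (by rw [ratBits] at h; lia)).le

theorem den_le_two_pow (h : ratBits q ≤ B) : q.den ≤ 2 ^ B :=
  (Nat.size_le.1 (by rw [ratBits] at h; lia)).le

theorem abs_le_two_pow (h : ratBits q ≤ B) : |q| ≤ 2 ^ B :=
  calc |q| = q.num.natAbs / q.den := abs_eq_natAbs_num_div_den q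
    _ ≤ q.num.natAbs := div_le_self (by positivity) (by exact_mod_cast q.pos)
    _ ≤ 2 ^ B := by exact_mod_cast natAbs_num_le_two_pow h

theorem ratBits_le (habs : |q| ≤ 2 ^ k) (hden : q.den ≤ 2 ^ l) : ratBits q ≤ k + 2 * l + 3 := by
  have hsize : ∀ {x j : ℕ}, x ≤ 2 ^ j → x.size ≤ j + 1 := fun h =>
    Nat.size_le.2 (h.trans_lt (Nat.pow_lt_pow_succ one_lt_two))
  have hnum : q.num.natAbs ≤ 2 ^ (k + l) := by
    have : (q.num.natAbs : ℚ) ≤ 2 ^ k * 2 ^ l :=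
      calc (q.num.natAbs : ℚ) = |q| * q.den := by
            rw [abs_eq_natAbs_num_div_den, div_mul_cancel₀ _ (by exact_mod_cast q.den_nz)]
        _ ≤ 2 ^ k * 2 ^ l := by
            gcongr
            exact_mod_cast hden
    rw [pow_add]
    exact_mod_cast this
  have := hsize hnum
  have := hsize hden
  rw [ratBits]
  lia

theorem ratBits_add_le (h₀ : ratBits q₀ ≤ B) (h₁ : ratBits q₁ ≤ B) (hu : |u| ≤ B + 1)
    (hv : |v| ≤ B + 1) : ratBits (u * q₀ + v * q₁) ≤ 6 * B + 4 := by
  have hcoeff : ∀ {w : ℤ}, |w| ≤ B + 1 → |(w : ℚ)| ≤ 2 ^ B := fun hw => by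
    have hpow : B + 1 ≤ 2 ^ B := Nat.lt_two_pow_self
    exact_mod_cast hw.trans (by exact_mod_cast hpow)
  have habs : |(u * q₀ + v * q₁ : ℚ)| ≤ 2 ^ (2 * B + 1) :=
    calc |(u * q₀ + v * q₁ : ℚ)| ≤ |(u : ℚ)| * |q₀| + |(v : ℚ)| * |q₁| := by
          rw [← abs_mul, ← abs_mul]
          exact abs_add_le _ _
      _ ≤ 2 ^ B * 2 ^ B + 2 ^ B * 2 ^ B := by
          gcongr
          exacts [hcoeff hu, abs_le_two_pow h₀, hcoeff hv, abs_le_two_pow h₁]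
      _ = 2 ^ (2 * B + 1) := by ring
  have hdvd : (u * q₀ + v * q₁ : ℚ).den ∣ q₀.den * q₁.den :=
    (Rat.add_den_dvd _ _).trans (Nat.mul_dvd_mul (by simpa using Rat.mul_den_dvd u q₀)
      (by simpa using Rat.mul_den_dvd v q₁))
  have hden : (u * q₀ + v * q₁ : ℚ).den ≤ 2 ^ (2 * B) :=
    calc (u * q₀ + v * q₁ : ℚ).den ≤ q₀.den * q₁.den :=
          Nat.le_of_dvd (Nat.mul_pos q₀.pos q₁.pos) hdvd
      _ ≤ 2 ^ B * 2 ^ B := Nat.mul_le_mul (den_le_two_pow h₀) (den_le_two_pow h₁)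
      _ = 2 ^ (2 * B) := by ring
  exact (ratBits_le habs hden).trans (by lia)

theorem ratBits_le_instBits (q : Fin n → Fin m → ℚ) (i : Fin n) (j : Fin m) :
    ratBits (q i j) ≤ instBits q :=
  calc ratBits (q i j) ≤ ∑ j, ratBits (q i j) :=
        Finset.single_le_sum (f := fun j => ratBits (q i j)) (by simp) (Finset.mem_univ j)
    _ ≤ ∑ i, ∑ j, ratBits (q i j) :=
        Finset.single_le_sum (f := fun i => ∑ j, ratBits (q i j)) (by simp) (Finset.mem_univ i)
    _ ≤ instBits q := Nat.le_add_left _ _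

/-- If the costs are rational, then so is `y`, with a bit length linear in that of the instance. -/
def HasFewBits (c : Fin n → Fin m → ℝ) (y : ℝ) : Prop :=
  ∀ q : Fin n → Fin m → ℚ, (∀ i j, c i j = q i j) →
    ∃ r : ℚ, y = r ∧ ratBits r ≤ 6 * instBits q + 4

theorem covers_hasFewBits (c : Fin n → Fin m → ℝ) (i : Fin n) (j : Fin m) (i' : Fin n)
    (j' : Fin m) : Covers (HasFewBits c) m (c i j) (c i' j') := by
  intro u v hu hv q hq
  have hm : m ≤ instBits q := by
    rw [instBits]
    lia
  refine ⟨u * q i j + v * q i' j', ?_, ratBits_add_le (ratBits_le_instBits q i j)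
    (ratBits_le_instBits q i' j') (by lia) (by lia)⟩
  rw [hq, hq]
  push_cast
  rfl

end Bits

section Preparation

variable {n m N : ℕ} {G : ℝ → Prop} {c : Fin n → Fin m → ℝ} {E : Fin n → Fin m → Prop} {a b : ℝ}
  {W : List ℕ} {s t : State} {i k p : Fin n} {j l q : Fin m}

theorem Bivalued.not_lt_of_lt (hc : Bivalued c a b) (h : c i j < c k l) : ¬ c p q < c i j := by
  rcases hc i j with hij | hij <;> rcases hc k l with hkl | hkl <;> rcases hc p q with hpq | hpq <;>
    simp only [hij, hkl, hpq] at * <;> order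

theorem Bivalued.of_le (hc : Bivalued c a b) (hlo : ∀ p q, c i j ≤ c p q)
    (hhi : ∀ p q, c p q ≤ c k l) : Bivalued c (c i j) (c k l) := fun p q => by
  by_contra! h
  exact hc.not_lt_of_lt ((hhi p q).lt_of_ne h.2) ((hlo p q).lt_of_ne' h.1)

/-- The input cells hold the instance `c`. -/
structure HoldsInput (c : Fin n → Fin m → ℝ) (s : State) : Prop where
  agents : ix s .input 0 0 = n
  chores : ix s .input 0 1 = m
  costs : ∀ (i : Fin n) (j : Fin m), nm s .input i j = c i j

theorem holdsInput_inputState (c : Fin n → Fin m → ℝ) : HoldsInput c (inputState c) where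
  agents := rfl
  chores := rfl
  costs i j := dif_pos ⟨rfl, i.2, j.2⟩

theorem HoldsInput.frame (h : HoldsInput c s) (hW : Frame W s t)
    (hinput : Arr.input.code ∉ W := by decide) : HoldsInput c t where
  agents := (hW.ix_eq _ hinput).trans h.agents
  chores := (hW.ix_eq _ hinput).trans h.chores
  costs i j := (hW.nm_eq _ hinput).trans (h.costs i j)

/-- The program that stores a cost in the variable `A`, namely one that passes the comparison `b`
with the cost in the first cell, if there is any, and the one in the first cell otherwise. -/
def findPrice (A : Arr) (b : Test) : Prog :=
  .setNum (var A) (.copy (cell .input (.const 0) (.const 0))) ;;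
  findPair 1 b ;;
  .branch (ltIdx (val .foundRow) (dim 0))
    (.setNum (var A) (.copy (cell .input (val .foundRow) (val .foundCol)))) skip

/-- The program that stores the least cost in `lo` and the greatest one in `hi`. -/
def findPrices : Prog :=
  findPrice .lo (ltNum (cell .input (val .row) (val .col)) (var .lo)) ;;
  findPrice .hi (ltNum (var .hi) (cell .input (val .row) (val .col)))

/-- The program that marks the pairs of an agent and a chore that is easy for her. -/
def markEasy : Prog :=
  forLoop .row 0 (forLoop .col 1
    (find 1 (ltNum (cell .input (val .row) (val .pos)) (cell .input (val .row) (val .col))) ;;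
      .setIdx (cell .easy (val .row) (val .col)) (.sub (.add (val .found) (.const 1)) (dim 1))))

/-- The program that marks the hard chores and gives every other chore to an agent for whom it is
easy. -/
def assignEasy : Prog :=
  forLoop .col 1
    (find 0 (isSet (get .easy (val .pos) (val .col))) ;;
      -- The search ends with `found = n` for a hard chore. Its mark is `1`, and subtracting the
      -- mark from `found` gives the number of an agent.
      .setIdx (entry .hard (val .col)) (.sub (.add (val .found) (.const 1)) (dim 0)) ;;
      .setIdx (entry .home (val .col)) (.sub (val .found) (elem .hard (val .col))))

/-- The program that fills the arrays of the initial pricing. -/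
def initPricing : Prog :=
  fill .normal 1 (.sub (.const 1) (elem .hard (val .pos))) ;;
  fill .everyone 0 (.const 1) ;;
  .setNum (var .zero) (.const 0)

/-- The program that computes a market for the instance. -/
def initMarket : Prog := findPrices ;; markEasy ;; assignEasy ;; initPricing

theorem wp_findPrice {A : Arr} {b : Test} {R : ℝ → ℝ → Prop} (hs : HoldsInput c s) (hn : n ≤ N)
    (hm : m ≤ N) (hn0 : 0 < n) (hm0 : 0 < m) (hG : ∀ i j, G (c i j))
    (hb : ∀ t (i : Fin n) (j : Fin m), HoldsInput c t → ix t .row 0 0 = i → ix t .col 0 0 = j →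
      (b.Holds t ↔ R (c i j) (nm t A 0 0)))
    (hR : ∀ i j k l p q, R (c i j) (c k l) → ¬ R (c p q) (c i j))
    (hA : A.code ∉ [Arr.input.code, Arr.foundRow.code, Arr.foundCol.code, Arr.row.code,
      Arr.col.code, Arr.idle.code] := by decide) :
    wp N G (findPrice A b) (fun t => ∃ i j, nm t A 0 0 = c i j ∧ ∀ k l, ¬ R (c k l) (c i j)) s := by
  have hcorner : content s (cell .input (.const 0) (.const 0)) = c ⟨0, hn0⟩ ⟨0, hm0⟩ :=
    hs.costs ⟨0, hn0⟩ ⟨0, hm0⟩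
  simp only [List.mem_cons, not_or] at hA
  refine wp_seq.2 (wp_copy.2 ⟨hcorner ▸ hG _ _, ?_⟩)
  rw [hcorner]
  have hset : Frame [A.code] s (setNm s A 0 0 (c ⟨0, hn0⟩ ⟨0, hm0⟩)) :=
    (Frame.refl _ s).setNm_right (by simp)
  have hs := hs.frame hset (by simpa using Ne.symm hA.1)
  refine wp_seq.2 (wp_bind (wp_findPair (R := fun i j => R (c i j) (c ⟨0, hn0⟩ ⟨0, hm0⟩)) hs.agents
    hs.chores hn hm fun i j t ht hi hj => ?_) fun t ht hfound => ?_)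
  · rw [hb t i j (hs.frame ht) hi hj, ht.nm_eq A (by simpa using hA.2)]
    simp
  have hwrites : writes (findPair 1 b) = [Arr.foundRow.code, Arr.row.code, Arr.col.code,
    Arr.foundRow.code, Arr.foundCol.code, Arr.idle.code, Arr.col.code, Arr.row.code] := rfl
  rw [hwrites] at ht
  have hs := hs.frame ht
  have hprice : nm t A 0 0 = c ⟨0, hn0⟩ ⟨0, hm0⟩ := by
    rw [ht.nm_eq A (by simp [hA])]
    simp
  rcases hfound with ⟨hfound, hno⟩ | ⟨i, j, hi, hj, hij⟩
  · exact wp_branch.2 ⟨fun hlt => absurd hlt (by simp [hfound, hs.agents]),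
      fun _ => ⟨_, _, hprice, hno⟩⟩
  · refine wp_branch.2 ⟨fun _ => wp_copy.2 ?_, fun hge => absurd hge (by simp [hi, hs.agents])⟩
    simp only [content_cell, index_eval_get, index_eval_const, hi, hj, hs.costs]
    exact ⟨hG i j, i, j, by simp, fun k l => hR i j _ _ k l hij⟩

theorem wp_findPrices (hs : HoldsInput c s) (hn : n ≤ N) (hm : m ≤ N) (hn0 : 0 < n) (hm0 : 0 < m)
    (hG : ∀ i j, G (c i j)) (hc : Bivalued c a b) :
    wp N G findPrices (fun t => ∃ i j k l, nm t .lo 0 0 = c i j ∧ nm t .hi 0 0 = c k l ∧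
      (∀ p q, c i j ≤ c p q) ∧ ∀ p q, c p q ≤ c k l) s := by
  refine wp_seq.2 (wp_bind (wp_findPrice (R := (· < ·)) hs hn hm hn0 hm0 hG
    (fun t i j ht hi hj => by simp [hi, hj, ht.costs]) fun i j k l p q => hc.not_lt_of_lt)
    fun t ht ⟨i, j, hlo, hmin⟩ => ?_)
  refine wp_bind (wp_findPrice (R := fun x y => y < x) (hs.frame ht) hn hm hn0 hm0 hG
    (fun t i j ht hi hj => by simp [hi, hj, ht.costs])
    fun i j k l p q h h' => hc.not_lt_of_lt h' h) fun u hu ⟨k, l, hhi, hmax⟩ => ?_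
  exact ⟨i, j, k, l, (hu.nm_eq .lo).trans hlo, hhi, fun p q => not_lt.1 (hmin p q),
    fun p q => not_lt.1 (hmax p q)⟩

theorem wp_markEasy (hs : HoldsInput c s) (hn : n ≤ N) (hm : m ≤ N) :
    wp N G markEasy (fun t => ∀ (i : Fin n) (j : Fin m), 0 < ix t .easy i j ↔ Easy c i j) s := by
  refine wp_mono (wp_forLoop (fun k t => ∀ (i : Fin n) (j : Fin m), (i : ℕ) < k →
    (0 < ix t .easy i j ↔ Easy c i j)) hs.agents hn (by simp) (by simp) fun k hk t ht hkt h => ?_)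
    fun t ht i j => ht i j i.2
  refine wp_mono (wp_forLoop (fun l t => ∀ (i : Fin n) (j : Fin m),
    (i : ℕ) < k ∨ (i : ℕ) = k ∧ (j : ℕ) < l → (0 < ix t .easy i j ↔ Easy c i j))
    (hs.frame ht).chores hm (by simpa using h) (by simp) fun l hl u hu hlu h => ?_)
    fun u hu i j hi => hu i j (by lia)
  have hs := (hs.frame ht).frame hu
  have hku := (hu.ix_eq .row).trans hkt
  refine wp_seq.2 (wp_bind (wp_find (R := fun l' => c ⟨k, hk⟩ l' < c ⟨k, hk⟩ ⟨l, hl⟩) hs.chores hm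
    fun l' v hv hl' => ?_) fun v hv hfound => wp_setIdx.2 fun i j hij => ?_)
  · have hs := hs.frame hv
    simp [hl', hv.ix_eq .row, hv.ix_eq .col, hku, hlu, hs.costs ⟨k, hk⟩ l',
      hs.costs ⟨k, hk⟩ ⟨l, hl⟩]
  · have hinput := (hv.ix_eq .input).trans hs.chores
    have hvalue : 0 < ix v .found 0 0 + 1 - m ↔ Easy c ⟨k, hk⟩ ⟨l, hl⟩ := by
      rcases hfound with ⟨hfound, hno⟩ | ⟨l', hfound, hlt⟩
      · exact iff_of_true (by lia) fun l' => not_lt.1 (hno l')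
      · exact iff_of_false (by lia) fun h => (h l').not_gt hlt
    by_cases hkl : (i : ℕ) = k ∧ (j : ℕ) = l
    · obtain ⟨rfl, rfl⟩ := hkl
      simpa [hv.ix_eq .row, hv.ix_eq .col, hku, hlu, hinput] using hvalue
    · simpa [hv.ix_eq .row, hv.ix_eq .col, hku, hlu, hkl, hv.ix_eq .easy] using h i j (by lia)

theorem wp_assignEasy (hagents : ix s .input 0 0 = n) (hchores : ix s .input 0 1 = m) (hn : n ≤ N)
    (hm : m ≤ N) (hn0 : 0 < n)
    (hE : ∀ (i : Fin n) (j : Fin m), 0 < ix s .easy i j ↔ E i j) :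
    wp N G assignEasy (fun t => Flags t .hard {j | ∀ i, ¬ E i j} ∧
      ∃ o : Fin m → Fin n, Stores t .home o ∧ ∀ i j, E i j → E (o j) j) s := by
  let Assigned : Fin m → State → Prop := fun j t => (0 < ix t .hard 0 j ↔ ∀ i, ¬ E i j) ∧
    ∃ e : Fin n, ix t .home 0 j = e ∧ ∀ i, E i j → E e j
  refine wp_mono (wp_forLoop (fun k t => ∀ j : Fin m, (j : ℕ) < k → Assigned j t) hchores hm
    (by simp) (by simp [Assigned]) fun k hk t ht hkt h => ?_) fun t h => ?_
  · refine wp_seq.2 (wp_bind (wp_find (R := (E · ⟨k, hk⟩)) ((ht.ix_eq .input).trans hagents) hn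
      fun i u hu hi => ?_) fun u hu hfound => ?_)
    · simp [hi, hu.ix_eq .col, hkt, hu.ix_eq .easy, ht.ix_eq .easy, ← hE]
    have hku := (hu.ix_eq .col).trans hkt
    have hagents := ((hu.ix_eq .input).trans (ht.ix_eq .input)).trans hagents
    refine wp_seq.2 (wp_setIdx.2 (wp_setIdx.2 fun j hj => ?_))
    rcases Nat.lt_succ_iff_lt_or_eq.1 hj with hj | rfl
    · simpa [Assigned, hku, hj.ne, hu.ix_eq .hard, hu.ix_eq .home] using h j hj
    · rcases hfound with ⟨hfound, hno⟩ | ⟨e, hfound, he⟩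
      · exact ⟨iff_of_true (by simp [hku, hagents, hfound]) hno, ⟨n - 1, Nat.sub_one_lt_of_lt hn0⟩,
          by simp [hku, hagents, hfound], fun i hi => absurd hi (hno i)⟩
      · have he' : (e : ℕ) + 1 - n = 0 := by lia
        exact ⟨iff_of_false (by simp [hku, hagents, hfound, he']) fun hno => hno e he, e,
          by simp [hku, hagents, hfound, he'], fun _ _ => he⟩
  · choose e he hE' using fun j => (h j j.2).2
    exact ⟨fun j => (h j j.2).1, e, he, fun i j => hE' j i⟩

theorem wp_initPricing {S : Set (Fin m)} (hagents : ix s .input 0 0 = n)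
    (hchores : ix s .input 0 1 = m) (hn : n ≤ N) (hm : m ≤ N) (hG : G 0)
    (hS : Flags s .hard S) :
    wp N G initPricing (fun t => Flags t .normal Sᶜ ∧ Flags t .everyone (Set.univ : Set (Fin n)) ∧
      nm t .zero 0 0 = 0) s := by
  refine wp_seq.2 (wp_bind (wp_fill (f := fun j => 1 - ix s .hard 0 j) hchores hm
    fun j t ht hj => ?_) fun t ht hnormal => ?_)
  · simp [hj, ht.ix_eq .hard]
  refine wp_seq.2 (wp_bind (wp_fill (n := n) (f := fun _ => 1) ((ht.ix_eq .input).trans hagents) hn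
    fun _ _ _ _ => rfl) fun u hu heveryone => wp_zero.2 ⟨hG, fun j => ?_, fun i => ?_, ?_⟩)
  · rw [ix_setNm, hu.ix_eq .normal, hnormal, Set.mem_compl_iff, ← hS]
    lia
  · simp [heveryone]
  · simp

end Preparation

section Solution

variable {n m N : ℕ} {G : ℝ → Prop} {c : Fin n → Fin m → ℝ} {M : Market n m} {a b : ℝ} {s : State}

/-- The easy chores and the prices of the market `M` come from the instance `c`. -/
structure Market.Describes (M : Market n m) (c : Fin n → Fin m → ℝ) : Prop where
  easy : M.easy = Easy c
  easy_home : ∀ j ∉ M.hard, M.easy (M.home j) j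
  bivalued : Bivalued c M.lo M.hi
  lo_le_hi : M.lo ≤ M.hi
  exists_lo : ∃ i j, M.lo = c i j
  exists_hi : ∃ i j, M.hi = c i j

theorem wp_initMarket (hs : HoldsInput c s) (hn : n ≤ N) (hm : m ≤ N) (hn0 : 0 < n) (hm0 : 0 < m)
    (hG : ∀ i j k l, Covers G m (c i j) (c k l)) (hc : Bivalued c a b) :
    wp N G initMarket (fun t => ∃ M : Market n m, M.Describes c ∧ Prepared M t) s := by
  refine wp_seq.2 (wp_bind (wp_findPrices hs hn hm hn0 hm0 (fun i j => (hG i j i j).left) hc)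
    fun t₁ ht₁ ⟨i, j, k, l, hlo, hhi, hmin, hmax⟩ => ?_)
  have hs := hs.frame ht₁
  refine wp_seq.2 (wp_bind (wp_markEasy hs hn hm) fun t₂ ht₂ heasy => ?_)
  have hs := hs.frame ht₂
  refine wp_seq.2 (wp_bind (wp_assignEasy hs.agents hs.chores hn hm hn0 heasy)
    fun t₃ ht₃ ⟨hhard, o, ho, heasy_home⟩ => ?_)
  have hs := hs.frame ht₃
  refine wp_bind (wp_initPricing hs.agents hs.chores hn hm (hG i j k l).zero hhard)
    fun t₄ ht₄ ⟨hnormal, heveryone, hzero⟩ => ⟨⟨Easy c, o, c i j, c k l⟩, ?_, ?_⟩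
  · exact
      { easy := rfl
        easy_home j hj := by
          obtain ⟨e, he⟩ := not_forall_not.1 hj
          exact heasy_home e j he
        bivalued := hc.of_le hmin hmax
        lo_le_hi := hmin k l
        exists_lo := ⟨i, j, rfl⟩
        exists_hi := ⟨k, l, rfl⟩ }
  · have hs := hs.frame ht₄
    exact
      { agents := hs.agents
        chores := hs.chores
        easy i j := by rw [ht₄.ix_eq .easy, ht₃.ix_eq .easy, heasy]
        home := ht₄.stores ho
        hard := ht₄.flags hhard
        normal := hnormal
        everyone := heveryone
        zero := hzero
        lo := by rw [ht₄.nm_eq .lo, ht₃.nm_eq .lo, ht₂.nm_eq .lo, hlo]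
        hi := by rw [ht₄.nm_eq .hi, ht₃.nm_eq .hi, ht₂.nm_eq .hi, hhi] }

theorem wp_balanceHome (hM : M.Describes c) (hs : Prepared M s) (hc : ∀ i j, 0 < c i j)
    (hG : Covers G m M.lo M.hi) :
    wp (rounds n m) G (balance .initial)
      (fun t => ∃ M : Market n m, M.Describes c ∧ M.Valid ∧ Prepared M t) s := by
  have hlo : 0 < M.lo := by
    obtain ⟨i, j, h⟩ := hM.exists_lo
    exact h ▸ hc i j
  refine wp_bind (wp_balance hG.zero_left hs.represents_initial hs.home le_rfl
    (hlo.le.trans hM.lo_le_hi)) fun t ht ⟨o, ho, hre, hbal⟩ => ?_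
  have hhome : ∀ j ∉ M.hard, M.easy (o j) j := fun j hj => by
    rcases hre.accepted j hj with h | h
    · exact h
    · rw [h]
      exact hM.easy_home j hj
  exact ⟨{ M with home := o }, { hM with easy_home := hhome },
    ⟨hlo, hM.lo_le_hi, hhome, hbal⟩, hs.rehome ht ho⟩

/-- The program that computes the allocation. -/
def solve : Prog :=
  .branch (isSet (dim 1)) (initMarket ;; balance .initial ;; stages) skip

theorem wp_solve (hn : 0 < n) (hpos : ∀ i j, 0 < c i j) (hc : Bivalued c a b) :
    wp (rounds n m) (HasFewBits c) solve
      (fun t => ∃ o p, Stores t .owner o ∧ (∀ j, 0 < p j) ∧ OnMBB c (bundles o) p ∧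
        PEF1 (bundles o) p) (inputState c) := by
  have hN := add_le_rounds n m
  have hs := holdsInput_inputState c
  refine wp_branch.2 ⟨fun hm => ?_, fun hm => ?_⟩
  · have hm : 0 < m := by simpa [hs.chores] using hm
    refine wp_seq.2 (wp_mono (wp_initMarket hs (by lia) (by lia) hn hm (covers_hasFewBits c) hc)
      fun t₁ ⟨M₁, hM₁, ht₁⟩ => ?_)
    have hG : ∀ {M : Market n m}, M.Describes c → Covers (HasFewBits c) m M.lo M.hi := fun hM => by
      obtain ⟨i, j, hlo⟩ := hM.exists_lo
      obtain ⟨k, l, hhi⟩ := hM.exists_hi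
      rw [hlo, hhi]
      exact covers_hasFewBits c i j k l
    refine wp_seq.2 (wp_mono (wp_balanceHome hM₁ ht₁ hpos (hG hM₁))
      fun t₂ ⟨M, hM, hvalid, ht₂⟩ => ?_)
    refine wp_mono (wp_stages hvalid (hG hM) ht₂ hn)
      fun t₃ ⟨o, τ, ho, hstage, hle⟩ => ⟨o, (M.raised (M.layer τ)).price, ho, hvalid.price_pos,
        hstage.onMBB hvalid (hvalid.isLayer_layer τ) hM.bivalued hM.easy,
        Pricing.pef1_of_forall_load_le hle⟩
  · obtain rfl : m = 0 := by simpa [hs.chores] using hm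
    exact wp_setIdx.2 ⟨Fin.elim0, Fin.elim0, Fin.rec0, Fin.rec0, fun _ j => j.elim0,
      fun _ _ => .inl (Finset.eq_empty_of_isEmpty _)⟩

theorem outputBundles_eq {o : Fin m → Fin n} (ho : Stores s .owner o) :
    outputBundles n m s = bundles o := by
  ext i j
  have hj : s.idx (1, 0, j) = o j := ho j
  simp [outputBundles, hj, Fin.val_inj]

end Solution

end BivaluedChores

open BivaluedChores in
/-- One program computes, for every bivalued instance of indivisible chores, an allocation that is
EF1 and fractionally Pareto-optimal, being supported by positive prices for which it is on minimum
bang-per-buck and price-EF1. It does so in strongly polynomial time: the number of steps is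
polynomial in the numbers of agents and chores, and on rational input the numbers that arise are
rationals of bit length polynomial in the encoding length of the input. -/
theorem theorem1 :
    ∃ (P : Prog) (T S : Polynomial ℕ), ∀ (n m : ℕ) (c : Fin n → Fin m → ℝ) (a b : ℝ),
      0 < n → 0 < a → 0 < b → (∀ i j, c i j = a ∨ c i j = b) →
      ∃ (t : ℕ) (L : List ℝ) (s : State), Exec P (inputState c) t L s ∧
        t ≤ T.eval (n + m) ∧
        (∀ q : Fin n → Fin m → ℚ, (∀ i j, c i j = (q i j : ℝ)) →
          ∀ y ∈ L, ∃ r : ℚ, y = (r : ℝ) ∧ ratBits r ≤ S.eval (instBits q)) ∧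
        IsAllocation (outputBundles n m s) ∧
        EF1 c (outputBundles n m s) ∧
        FPO c (outputBundles n m s) ∧
        ∃ p : Fin m → ℝ, (∀ j, 0 < p j) ∧
          OnMBB c (outputBundles n m s) p ∧ PEF1 (outputBundles n m s) p := by
  refine ⟨solve, (timeBound solve).comp ((.X + 2) ^ 5), 6 * .X + 4,
    fun n m c a b hn ha hb hc => ?_⟩
  have hpos : ∀ i j, 0 < c i j := fun i j => by
    rcases hc i j with h | h <;> rwa [h]
  obtain ⟨t, L, s, hexec, ht, hL, o, p, ho, hp, hmbb, hpef⟩ :=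
    exists_exec_of_wp (wp_solve hn hpos hc)
  refine ⟨t, L, s, hexec, ?_⟩
  rw [outputBundles_eq ho]
  refine ⟨?_, fun q hq y hy => ?_, isAllocation_bundles o,
    ef1_of_onMBB hpos hp hmbb hpef, fpo_of_onMBB hpos hp hmbb, p, hp, hmbb, hpef⟩
  · simpa [rounds] using ht
  · simpa using hL y hy q hq
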